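/- Let $M$ be a smooth four-dimensional manifold with a global cobase field: smooth $1$-forms $(g^\alpha)_{0\le\alpha\le3}$ dual to a smooth base field $(E_\alpha)$ of vector fields, $g^\alpha(E_\beta)=\delta^\alpha_\beta$. Put $(\eta_{\alpha\beta})=\mathrm{diag}(-1,1,1,1)$, raise and lower indices with $\eta$ (so $g_\alpha=\eta_{\alpha\beta}g^\beta$), sum over repeated indices, and give $M$ the Lorentzian metric $\mathbf g=\eta_{\alpha\beta}\,g^\alpha\otimes g^\beta$ and the orientation $g^0\wedge g^1\wedge g^2\wedge g^3$. Let $\langle\cdot|\cdot\rangle$ be the induced scalar product of forms and $\star$ the Hodge dual, normalized by $\omega\wedge\star\psi=\langle\omega|\psi\rangle\star1$ with $\star 1=g^0\wedge g^1\wedge g^2\wedge g^3$. Let $\delta=-\star d\,\star$, let $i_X$ be the interior product with a vector field $X$, and $i_\alpha=i_{E_\alpha}$. Define the gravitational energy-momentum currents $$\mathcal T_\alpha=\tfrac12\star\left(dg_\beta\wedge i_\alpha\star dg^\beta-i_\alpha dg_\beta\wedge\star dg^\beta\right)+\tfrac12(\delta g_\beta)(\delta g^\beta)\,g_\alpha+(i_\beta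 d\delta g^\beta)\,g_\alpha-(i_\alpha d\delta g^\beta)\,g_\beta .$$ Let $(\mathcal J_\alpha)$ be $1$-forms (the matter currents) such that the field equations $$\delta dg_\alpha=\mathcal T_\alpha+\mathcal J_\alpha\qquad(0\le\alpha\le3)$$ hold. Let $\xi$ be a smooth Killing vector field of $\mathbf g$ (that is, $\mathcal L_\xi\mathbf g=0$) and let $$\mathcal W_\xi=\tfrac12\star\left(dg_\beta\wedge i_\xi\star dg^\beta-i_\xi dg_\beta\wedge\star dg^\beta\right)$$ be the energy-flow of the gravitational potentials $(g_\alpha)$ along $\xi$. Then, everywhere on $M$, $$\delta\mathcal W_\xi=-\left\langle i_\xi dg_\alpha\,\middle|\,\mathcal T^\alpha+\mathcal J^\alpha\right\rangle .$$ -/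

import Mathlib

open scoped Manifold ContDiff

namespace GravForce

/-! ### Exterior algebra of a single (tangent) space `V` -/

section Pointwise

variable {V : Type*} [AddCommGroup V] [Module ℝ V] [TopologicalSpace V]

/-- The multilinear map `v ↦ ω (v₁, …, v_p) * η (v_{p+1}, …, v_{p+q})`. -/
noncomputable def prodMultilinear {p q : ℕ} (w : V [⋀^Fin p]→L[ℝ] ℝ) (η : V [⋀^Fin q]→L[ℝ] ℝ) :
    ContinuousMultilinearMap ℝ (fun _ : Fin (p + q) => V) ℝ where
  toFun v := w (fun i => v (Fin.castAdd q i)) * η (fun j => v (Fin.natAdd p j))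
  map_update_add' := by
    intro inst v i x y
    obtain rfl : inst = instDecidableEqFin (p + q) := Subsingleton.elim _ _
    refine Fin.addCases (fun a => ?_) (fun b => ?_) i
    · have hl : ∀ z : V, (fun k => Function.update v (Fin.castAdd q a) z (Fin.castAdd q k)) =
          Function.update (fun k => v (Fin.castAdd q k)) a z := fun z =>
        Function.update_comp_eq_of_injective v (Fin.castAdd_injective p q) a z
      have hr : ∀ z : V, (fun k => Function.update v (Fin.castAdd q a) z (Fin.natAdd p k)) =
          fun k => v (Fin.natAdd p k) := fun z => by
        funext k
        exact Function.update_of_ne (by simp [Fin.ext_iff]; omega) _ _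
      simp only [hl, hr, ContinuousAlternatingMap.map_update_add, add_mul]
    · have hl : ∀ z : V, (fun k => Function.update v (Fin.natAdd p b) z (Fin.natAdd p k)) =
          Function.update (fun k => v (Fin.natAdd p k)) b z := fun z =>
        Function.update_comp_eq_of_injective v (Fin.natAdd_injective q p) b z
      have hr : ∀ z : V, (fun k => Function.update v (Fin.natAdd p b) z (Fin.castAdd q k)) =
          fun k => v (Fin.castAdd q k) := fun z => by
        funext k
        exact Function.update_of_ne (by simp [Fin.ext_iff]; omega) _ _
      simp only [hl, hr, ContinuousAlternatingMap.map_update_add, mul_add]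
  map_update_smul' := by
    intro inst v i c x
    obtain rfl : inst = instDecidableEqFin (p + q) := Subsingleton.elim _ _
    refine Fin.addCases (fun a => ?_) (fun b => ?_) i
    · have hl : ∀ z : V, (fun k => Function.update v (Fin.castAdd q a) z (Fin.castAdd q k)) =
          Function.update (fun k => v (Fin.castAdd q k)) a z := fun z =>
        Function.update_comp_eq_of_injective v (Fin.castAdd_injective p q) a z
      have hr : ∀ z : V, (fun k => Function.update v (Fin.castAdd q a) z (Fin.natAdd p k)) =
          fun k => v (Fin.natAdd p k) := fun z => by
        funext k
        exact Function.update_of_ne (by simp [Fin.ext_iff]; omega) _ _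
      simp only [hl, hr, ContinuousAlternatingMap.map_update_smul, smul_eq_mul, mul_assoc]
    · have hl : ∀ z : V, (fun k => Function.update v (Fin.natAdd p b) z (Fin.natAdd p k)) =
          Function.update (fun k => v (Fin.natAdd p k)) b z := fun z =>
        Function.update_comp_eq_of_injective v (Fin.natAdd_injective q p) b z
      have hr : ∀ z : V, (fun k => Function.update v (Fin.natAdd p b) z (Fin.castAdd q k)) =
          fun k => v (Fin.castAdd q k) := fun z => by
        funext k
        exact Function.update_of_ne (by simp [Fin.ext_iff]; omega) _ _
      simp only [hl, hr, ContinuousAlternatingMap.map_update_smul, smul_eq_mul, mul_left_comm]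
  cont := (w.coe_continuous.comp (by fun_prop)).mul (η.coe_continuous.comp (by fun_prop))

/-- The wedge product of a `p`-form and a `q`-form,
`(ω ∧ η)(v₁, …, v_{p+q}) = 1/(p! q!) ∑_σ sign(σ) ω(v_{σ 1}, …, v_{σ p}) η(v_{σ (p+1)}, …)`. -/
noncomputable def wedgeAt {p q : ℕ} (w : V [⋀^Fin p]→L[ℝ] ℝ) (η : V [⋀^Fin q]→L[ℝ] ℝ) :
    V [⋀^Fin (p + q)]→L[ℝ] ℝ :=
  ((p.factorial : ℝ) * (q.factorial : ℝ))⁻¹ •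
    ContinuousMultilinearMap.alternatization (prodMultilinear w η)

/-- The form `v ↦ ω (u₁, …, u_p, v₁, …, v_q)` obtained by inserting `u₁, …, u_p` in the first `p`
slots of a `(p + q)`-form. -/
noncomputable def insertFirst {p q n : ℕ} (h : p + q = n) (u : Fin p → V)
    (w : V [⋀^Fin n]→L[ℝ] ℝ) : V [⋀^Fin q]→L[ℝ] ℝ where
  toFun v := w (fun k => Fin.append u v (Fin.cast h.symm k))
  map_update_add' := by
    intro inst v i x y
    subst h
    obtain rfl : inst = instDecidableEqFin q := Subsingleton.elim _ _
    have hu : ∀ z : V, (fun k => Fin.append u (Function.update v i z) (Fin.cast rfl k)) =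
        Function.update (Fin.append u v) (Fin.natAdd p i) z := fun z => by
      funext k
      refine Fin.addCases (fun a => ?_) (fun b => ?_) k
      · rw [Function.update_of_ne (by simp [Fin.ext_iff]; omega)]
        simp
      · by_cases hb : b = i
        · subst hb; simp
        · rw [Function.update_of_ne (by simpa [Fin.ext_iff] using hb)]
          simp [hb]
    simp only [hu, ContinuousAlternatingMap.map_update_add]
  map_update_smul' := by
    intro inst v i c x
    subst h
    obtain rfl : inst = instDecidableEqFin q := Subsingleton.elim _ _
    have hu : ∀ z : V, (fun k => Fin.append u (Function.update v i z) (Fin.cast rfl k)) =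
        Function.update (Fin.append u v) (Fin.natAdd p i) z := fun z => by
      funext k
      refine Fin.addCases (fun a => ?_) (fun b => ?_) k
      · rw [Function.update_of_ne (by simp [Fin.ext_iff]; omega)]
        simp
      · by_cases hb : b = i
        · subst hb; simp
        · rw [Function.update_of_ne (by simpa [Fin.ext_iff] using hb)]
          simp [hb]
    simp only [hu, ContinuousAlternatingMap.map_update_smul]
  cont := by
    subst h
    refine w.coe_continuous.comp (continuous_pi fun k => ?_)
    refine Fin.addCases (fun a => ?_) (fun b => ?_) k
    · simpa using continuous_const
    · simpa using continuous_apply b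
  map_eq_zero_of_eq' := by
    intro v i j hv hij
    subst h
    refine w.map_eq_zero_of_eq _ (i := Fin.natAdd p i) (j := Fin.natAdd p j) ?_ ?_
    · simpa using hv
    · simpa [Fin.ext_iff] using hij

/-- The interior product `i_X ω = ω (X, ·, …, ·)`. -/
noncomputable def interiorAt {p : ℕ} (X : V) (w : V [⋀^Fin (p + 1)]→L[ℝ] ℝ) :
    V [⋀^Fin p]→L[ℝ] ℝ :=
  insertFirst (Nat.add_comm 1 p) (fun _ : Fin 1 => X) w

end Pointwise

/-- The diagonal entries of the Minkowski matrix `η = diag (-1, 1, 1, 1)`. -/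
def eta (α : Fin 4) : ℝ := if α = 0 then -1 else 1

/-! ### Differential forms on a four-dimensional manifold -/

section Manifold

variable {M : Type*} [TopologicalSpace M] [ChartedSpace (EuclideanSpace ℝ (Fin 4)) M]

/-- (Not necessarily smooth) vector fields on `M`. -/
abbrev VField (M : Type*) [TopologicalSpace M] [ChartedSpace (EuclideanSpace ℝ (Fin 4)) M] :=
  (x : M) → TangentSpace (𝓡 4) x

/-- (Not necessarily smooth) differential `p`-forms on `M`. -/
abbrev DForm (M : Type*) [TopologicalSpace M] [ChartedSpace (EuclideanSpace ℝ (Fin 4)) M]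
    (p : ℕ) :=
  (x : M) → TangentSpace (𝓡 4) x [⋀^Fin p]→L[ℝ] ℝ

/-- Smooth vector fields. -/
def VField.Smooth [IsManifold (𝓡 4) ∞ M] (X : VField M) : Prop :=
  ContMDiff (𝓡 4) (𝓡 4).tangent ∞ (fun x => (⟨x, X x⟩ : TangentBundle (𝓡 4) M))

/-- The expression of a `p`-form in the preferred chart `φ` at `x₀`, i.e. the pullback of the form
by `φ⁻¹`. -/
noncomputable def DForm.inChart {p : ℕ} (w : DForm M p) (x₀ : M) (y : EuclideanSpace ℝ (Fin 4)) :
    EuclideanSpace ℝ (Fin 4) [⋀^Fin p]→L[ℝ] ℝ :=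
  (w ((extChartAt (𝓡 4) x₀).symm y)).compContinuousLinearMap
    (mfderiv 𝓘(ℝ, EuclideanSpace ℝ (Fin 4)) (𝓡 4) (extChartAt (𝓡 4) x₀).symm y)

/-- Smooth forms: all chart expressions are smooth. -/
def DForm.Smooth {p : ℕ} (w : DForm M p) : Prop :=
  ∀ x₀ : M, ContDiffOn ℝ ∞ (w.inChart x₀) (extChartAt (𝓡 4) x₀).target

/-- The exterior derivative: at `x`, the exterior derivative of the expression of the form in the
preferred chart at `x`, pulled back to `M` by the chart. -/
noncomputable def DForm.d {p : ℕ} (w : DForm M p) : DForm M (p + 1) := fun x =>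
  (extDeriv (w.inChart x) (extChartAt (𝓡 4) x x)).compContinuousLinearMap
    (mfderiv (𝓡 4) 𝓘(ℝ, EuclideanSpace ℝ (Fin 4)) (extChartAt (𝓡 4) x) x)

/-- The wedge product of differential forms. -/
noncomputable def DForm.wedge {p q : ℕ} (w : DForm M p) (ψ : DForm M q) : DForm M (p + q) :=
  fun x => wedgeAt (w x) (ψ x)

/-- The interior product `i_X ω` of a form with a vector field. -/
noncomputable def DForm.interior {p : ℕ} (X : VField M) (w : DForm M (p + 1)) : DForm M p :=
  fun x => interiorAt (X x) (w x)

/-- The function underlying a `0`-form. -/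
noncomputable def DForm.toFun (f : DForm M 0) : M → ℝ := fun x => f x ![]

/-- A cobase field `(g^α)` of smooth `1`-forms on `M`, together with the base field `(E_α)` of
smooth vector fields that it is dual to. -/
structure Cobase (M : Type*) [TopologicalSpace M] [ChartedSpace (EuclideanSpace ℝ (Fin 4)) M]
    [IsManifold (𝓡 4) ∞ M] where
  /-- the base field `E_α` -/
  base : Fin 4 → VField M
  /-- the cobase field `g^α` -/
  form : Fin 4 → DForm M 1
  smooth_base : ∀ α, VField.Smooth (base α)
  smooth_form : ∀ α, DForm.Smooth (form α)
  dual : ∀ α β x, form α x (fun _ => base β x) = if α = β then 1 else 0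

namespace Cobase

variable [IsManifold (𝓡 4) ∞ M] (g : Cobase M)

/-- The potentials with lowered index, `g_α = η_{αβ} g^β`. -/
noncomputable def lower (α : Fin 4) : DForm M 1 := eta α • g.form α

/-- The induced Lorentzian metric `𝐠 = η_{αβ} g^α ⊗ g^β`. -/
noncomputable def metric (x : M) (u v : TangentSpace (𝓡 4) x) : ℝ :=
  ∑ α, eta α * g.form α x (fun _ => u) * g.form α x (fun _ => v)

/-- The induced scalar product `⟨ω|ψ⟩` of `1`-forms; `(E_α)` is `𝐠`-orthonormal. -/
noncomputable def inner (w ψ : DForm M 1) : M → ℝ := fun x =>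
  ∑ α, eta α * w x (fun _ => g.base α x) * ψ x (fun _ => g.base α x)

/-- The volume form (orientation) `τ = g⁰ ∧ g¹ ∧ g² ∧ g³`. -/
noncomputable def volume : DForm M 4 :=
  DForm.wedge (DForm.wedge (DForm.wedge (g.form 0) (g.form 1)) (g.form 2)) (g.form 3)

/-- The Hodge dual of `p`-forms, `p + q = 4`, for the metric `𝐠` and the orientation `τ`: in the
orthonormal base field,
`⋆ω = 1/p! ∑ ω^{α₁…α_p} τ(E_{α₁}, …, E_{α_p}, ·, …, ·)`, the indices of `ω` being raised by `η`. -/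
noncomputable def hodge {p q : ℕ} (h : p + q = 4) (w : DForm M p) : DForm M q := fun x =>
  (p.factorial : ℝ)⁻¹ • ∑ a : Fin p → Fin 4,
    ((∏ i, eta (a i)) * w x (fun i => g.base (a i) x)) •
      insertFirst h (fun i => g.base (a i) x) (g.volume x)

/-- The codifferential `δω = - ⋆ d ⋆ ω` of a `(p + 1)`-form, `p + 1 + q = 4`. -/
noncomputable def codiff {p q : ℕ} (h : p + 1 + q = 4) (w : DForm M (p + 1)) : DForm M p :=
  -(g.hodge (p := q + 1) (q := p) (by omega) (DForm.d (g.hodge h w)))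

/-- The codifferential `δ dg_α` of the `2`-form `dg_α`. -/
noncomputable def codiffD (α : Fin 4) : DForm M 1 :=
  g.codiff (p := 1) (q := 2) rfl (DForm.d (g.lower α))

/-- The function `δω` for a `1`-form `ω`. -/
noncomputable def codiffOne (w : DForm M 1) : M → ℝ :=
  DForm.toFun (g.codiff (p := 0) (q := 3) rfl w)

/-- The `1`-form `½ ⋆ (dg_β ∧ i_X ⋆dg^β - i_X dg_β ∧ ⋆dg^β)`, summed over `β`. For a Killing
field `X` this is the energy-flow `𝒲_X` of the gravitational potentials along `X`. -/
noncomputable def energyFlow (X : VField M) : DForm M 1 :=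
  (1 / 2 : ℝ) • g.hodge (p := 3) (q := 1) rfl (∑ β,
    ((DForm.wedge (DForm.d (g.lower β))
        (DForm.interior X (g.hodge (p := 2) (q := 2) rfl (DForm.d (g.form β)))) : DForm M 3) -
      (DForm.wedge (DForm.interior X (DForm.d (g.lower β)))
        (g.hodge (p := 2) (q := 2) rfl (DForm.d (g.form β))) : DForm M 3)))

/-- The gravitational energy-momentum currents
`𝒯_α = ½ ⋆ (dg_β ∧ i_α ⋆dg^β - i_α dg_β ∧ ⋆dg^β)
  + ½ δg_β δg^β g_α + (i_β dδg^β) g_α - (i_α dδg^β) g_β`, where `i_α` is the interior product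
with `E_α`. -/
noncomputable def current (α : Fin 4) : DForm M 1 :=
  g.energyFlow (g.base α) + ∑ β,
    ((fun x => ((1 / 2 : ℝ) * g.codiffOne (g.lower β) x * g.codiffOne (g.form β) x) •
        g.lower α x) +
      (fun x => DForm.toFun (DForm.interior (g.base β)
          (DForm.d (g.codiff (p := 0) (q := 3) rfl (g.form β)))) x • g.lower α x) -
      (fun x => DForm.toFun (DForm.interior (g.base α)
          (DForm.d (g.codiff (p := 0) (q := 3) rfl (g.form β)))) x • g.lower β x))

/-- The field equations `δ dg_α = 𝒯_α + 𝒥_α` with matter currents `𝒥_α`. -/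
def FieldEquations (J : Fin 4 → DForm M 1) : Prop :=
  ∀ α, g.codiffD α = g.current α + J α

/-- `X` is a Killing vector field of `𝐠`: it is smooth, and `ℒ_X 𝐠 = 0`, that is,
`X (𝐠(Y, Z)) = 𝐠([X, Y], Z) + 𝐠(Y, [X, Z])` for all smooth vector fields `Y`, `Z`. -/
def IsKilling (X : VField M) : Prop :=
  X.Smooth ∧ ∀ Y Z : VField M, Y.Smooth → Z.Smooth → ∀ x : M,
    mfderiv (𝓡 4) 𝓘(ℝ, ℝ) (fun y => g.metric y (Y y) (Z y)) x (X x) =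
      g.metric x (VectorField.mlieBracket (𝓡 4) X Y x) (Z x) +
        g.metric x (Y x) (VectorField.mlieBracket (𝓡 4) X Z x)

end Cobase

end Manifold

end GravForce

namespace GravForce

open VectorField Topology

/-! The field equations turn the right-hand side into -⟨i_ξ dg_α | δdg^α⟩. The explicit shape of 𝒯_α
then plays no role, and what remains is an identity about the four closed 2-forms F = dg^β. Each of
them contributes to 𝒲_ξ the covector -η_β T(ξ, ·), where T_{ab} = F_{ac} F_b^c - ¼ η_{ab} F_{cd}
F^{cd} is the Maxwell energy-momentum tensor of F (`flowForm_eq_stress`, `comp_energyFlow`). With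
the present signs δ is the divergence on 1-forms (`codiffOne_eq`). The divergence of T(ξ, ·) has two
parts: T^{ab} ∇_a ξ_b, which vanishes because T is symmetric and ξ is Killing, and (div T)(ξ), which
by dF = 0 reduces to the scalar product of i_ξ F and δF. This is `divergence_stress`; summing over β
gives `codiffOne_energyFlow`.

No connection is introduced. Everything is written in the orthonormal base field through the
structure functions c^k_{ab} = g^k([E_a, E_b]). The invariant formula for d (`DForm.d_apply`)
becomes a component formula (`comp_d`), the Hodge dual becomes a contraction with the Levi-Civita
symbol (`comp_hodge`), dF = 0 is the Jacobi identity (`bianchi`), and the Killing condition becomes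
an equation for the components of ξ (`IsKilling.dirDeriv_coord`). After this translation
`divergence_stress` is a polynomial identity modulo the Killing and closedness relations. -/

theorem neg_one_pow_zsmul_eq_mul (k : ℕ) (a : ℝ) : ((-1 : ℤ) ^ k) • a = (-1) ^ k * a := by
  simp

/-! ### Chart expressions of fields and forms; the invariant formula for d. -/

section Chart

variable {M : Type*} [TopologicalSpace M] [ChartedSpace (EuclideanSpace ℝ (Fin 4)) M]
  [IsManifold (𝓡 4) ∞ M]

/-- The expression of a vector field in the preferred chart at `x`. -/
noncomputable def VField.inChart (X : VField M) (x : M) (y : EuclideanSpace ℝ (Fin 4)) :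
    EuclideanSpace ℝ (Fin 4) :=
  mpullbackWithin 𝓘(ℝ, EuclideanSpace ℝ (Fin 4)) (𝓡 4) (extChartAt (𝓡 4) x).symm X
    (Set.range (𝓡 4)) y

/-- The chart expression is a pullback, defined with the inverse of this derivative; the derivative
is invertible on the whole chart target, so the two cancel. -/
theorem VField.mfderiv_symm_inChart (X : VField M) (x : M) {y : EuclideanSpace ℝ (Fin 4)}
    (hy : y ∈ (extChartAt (𝓡 4) x).target) :
    mfderiv 𝓘(ℝ, EuclideanSpace ℝ (Fin 4)) (𝓡 4) (extChartAt (𝓡 4) x).symm y (X.inChart x y) =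
      X ((extChartAt (𝓡 4) x).symm y) := by
  have : IsManifold (𝓡 4) 1 M := IsManifold.of_le (n := ∞) (by norm_num)
  have h := isInvertible_mfderivWithin_extChartAt_symm hy
  have e : mfderivWithin 𝓘(ℝ, EuclideanSpace ℝ (Fin 4)) (𝓡 4) (extChartAt (𝓡 4) x).symm
      (Set.range (𝓡 4)) y =
      mfderiv 𝓘(ℝ, EuclideanSpace ℝ (Fin 4)) (𝓡 4) (extChartAt (𝓡 4) x).symm y := by
    rw [ModelWithCorners.range_eq_univ, mfderivWithin_univ]
  rw [← e]
  unfold VField.inChart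
  rw [mpullbackWithin_apply]
  obtain ⟨A, hA⟩ := h
  rw [← hA, ContinuousLinearMap.inverse_equiv]
  exact A.apply_symm_apply _

theorem VField.inChart_self (X : VField M) (x : M) :
    X.inChart x (extChartAt (𝓡 4) x x) = X x := by
  have : IsManifold (𝓡 4) 1 M := IsManifold.of_le (n := ∞) (by norm_num)
  have h := mfderivWithin_extChartAt_symm_inverse_apply (I := 𝓡 4) (x := x) (v := X x)
  unfold VField.inChart
  rw [mpullbackWithin_apply]
  rw [extChartAt_to_inv]
  exact h

theorem VField.Smooth.contDiffAt_inChart {X : VField M} (hX : X.Smooth) (x : M) :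
    ContDiffAt ℝ ∞ (X.inChart x) (extChartAt (𝓡 4) x x) := by
  have h := contMDiffWithinAt_mpullbackWithin_extChartAt_symm (m := ∞) (n := ∞) (I := 𝓡 4)
    (s := Set.univ) (x := x) (V := X) (hX x).contMDiffWithinAt uniqueMDiffOn_univ
    (Set.mem_univ x) (by norm_num)
  have h2 := h.contMDiffAt (by
    simpa using extChartAt_target_mem_nhds (I := 𝓡 4) x)
  have h3 := (contMDiff_snd_tangentBundle_modelSpace (n := ∞) (EuclideanSpace ℝ (Fin 4))
    𝓘(ℝ, EuclideanSpace ℝ (Fin 4))).contMDiffAt.comp _ h2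
  exact h3.contDiffAt

theorem DForm.inChart_apply {p : ℕ} (w : DForm M p) (x : M) (V : Fin p → VField M)
    {y : EuclideanSpace ℝ (Fin 4)} (hy : y ∈ (extChartAt (𝓡 4) x).target) :
    w.inChart x y (fun i => (V i).inChart x y) =
      w ((extChartAt (𝓡 4) x).symm y) (fun i => V i ((extChartAt (𝓡 4) x).symm y)) := by
  change w _ (fun i => mfderiv _ _ _ y ((V i).inChart x y)) = _
  congr 1
  funext i
  exact (V i).mfderiv_symm_inChart x hy

/-- The preferred chart at `x` trivialises the tangent space at `x` itself, so its derivative there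
is the identity and no change of basis remains. -/
theorem DForm.inChart_self {p : ℕ} (w : DForm M p) (x : M)
    (u : Fin p → EuclideanSpace ℝ (Fin 4)) :
    w.inChart x (extChartAt (𝓡 4) x x) u = w x u := by
  have : IsManifold (𝓡 4) 1 M := IsManifold.of_le (n := ∞) (by norm_num)
  have h := mfderivWithin_range_extChartAt_symm (I := 𝓡 4) (x := x)
  rw [ModelWithCorners.range_eq_univ, mfderivWithin_univ] at h
  change w _ (fun i => mfderiv _ _ _ _ (u i)) = _
  rw [extChartAt_to_inv] at h ⊢
  rw [h]
  rfl

theorem mlieBracket_eq (X Y : VField M) (x : M) :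
    mlieBracket (𝓡 4) X Y x =
      lieBracket ℝ (X.inChart x) (Y.inChart x) (extChartAt (𝓡 4) x x) := by
  have : IsManifold (𝓡 4) 1 M := IsManifold.of_le (n := ∞) (by norm_num)
  have e : (extChartAt (𝓡 4) x).symm ⁻¹' Set.univ ∩ Set.range (𝓡 4) = Set.univ := by
    rw [ModelWithCorners.range_eq_univ, Set.preimage_univ, Set.univ_inter]
  have h := mlieBracketWithin_apply (I := 𝓡 4) (V := X) (W := Y) (s := Set.univ) (x₀ := x)
  rw [e, mfderiv_extChartAt_self] at h
  rw [← mlieBracketWithin_univ, h, ← lieBracketWithin_univ]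
  exact congrArg (fun L : EuclideanSpace ℝ (Fin 4) →L[ℝ] EuclideanSpace ℝ (Fin 4) => L _)
    ContinuousLinearMap.inverse_id

/-- The derivative of a function at `x` in the direction of a tangent vector. -/
noncomputable def dirDeriv (f : M → ℝ) (x : M) (v : TangentSpace (𝓡 4) x) : ℝ :=
  mfderiv (𝓡 4) 𝓘(ℝ, ℝ) f x v

theorem mdifferentiableAt_of_chart {f : M → ℝ} {x : M}
    (hf : DifferentiableAt ℝ (f ∘ (extChartAt (𝓡 4) x).symm) (extChartAt (𝓡 4) x x)) :
    MDifferentiableAt (𝓡 4) 𝓘(ℝ, ℝ) f x := by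
  have : IsManifold (𝓡 4) 1 M := IsManifold.of_le (n := ∞) (by norm_num)
  have h := hf.mdifferentiableAt.comp x
    (mdifferentiableAt_extChartAt (I := 𝓡 4) (x := x) (y := x) (mem_chart_source _ x))
  refine h.congr_of_eventuallyEq ?_
  filter_upwards [extChartAt_source_mem_nhds (I := 𝓡 4) x] with y hy
  simp only [Function.comp_apply, (extChartAt (𝓡 4) x).left_inv hy]

omit [IsManifold (𝓡 4) ∞ M] in
theorem contMDiffAt_of_chart {f : M → ℝ} {x : M}
    (hf : ContDiffAt ℝ ∞ (f ∘ (extChartAt (𝓡 4) x).symm) (extChartAt (𝓡 4) x x)) :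
    ContMDiffAt (𝓡 4) 𝓘(ℝ, ℝ) ∞ f x := by
  have h := hf.contMDiffAt.comp x (contMDiffAt_extChartAt (I := 𝓡 4) (x := x) (n := ∞))
  refine h.congr_of_eventuallyEq ?_
  filter_upwards [extChartAt_source_mem_nhds (I := 𝓡 4) x] with y hy
  simp only [Function.comp_apply, (extChartAt (𝓡 4) x).left_inv hy]

omit [IsManifold (𝓡 4) ∞ M] in
theorem differentiableAt_chart {f : M → ℝ} {x : M}
    (hf : MDifferentiableAt (𝓡 4) 𝓘(ℝ, ℝ) f x) :
    DifferentiableAt ℝ (f ∘ (extChartAt (𝓡 4) x).symm) (extChartAt (𝓡 4) x x) := by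
  have h := (mdifferentiableAt_iff _ _).1 hf
  have h2 := h.2
  simp only [ModelWithCorners.range_eq_univ, differentiableWithinAt_univ] at h2
  exact h2

omit [IsManifold (𝓡 4) ∞ M] in
theorem dirDeriv_eq_fderiv {f : M → ℝ} {x : M} (hf : MDifferentiableAt (𝓡 4) 𝓘(ℝ, ℝ) f x)
    (v : TangentSpace (𝓡 4) x) :
    dirDeriv f x v =
      fderiv ℝ (f ∘ (extChartAt (𝓡 4) x).symm) (extChartAt (𝓡 4) x x) v := by
  have h : mfderiv (𝓡 4) 𝓘(ℝ, ℝ) f x = fderivWithin ℝ (writtenInExtChartAt (𝓡 4) 𝓘(ℝ, ℝ) x f)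
      (Set.range (𝓡 4)) (extChartAt (𝓡 4) x x) := if_pos hf
  rw [ModelWithCorners.range_eq_univ, fderivWithin_univ] at h
  exact congrArg (fun L => L v) h

theorem DForm.apply_comp_symm_eventuallyEq {p : ℕ} (w : DForm M p) (x : M)
    (V : Fin p → VField M) :
    (fun z => w z (fun i => V i z)) ∘ (extChartAt (𝓡 4) x).symm
      =ᶠ[𝓝 (extChartAt (𝓡 4) x x)] fun y => w.inChart x y (fun i => (V i).inChart x y) := by
  filter_upwards [extChartAt_target_mem_nhds (I := 𝓡 4) x] with y hy
  exact (w.inChart_apply x V hy).symm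

theorem DForm.mdifferentiableAt_apply {p : ℕ} {w : DForm M p} {x : M}
    (hw : DifferentiableAt ℝ (w.inChart x) (extChartAt (𝓡 4) x x)) {V : Fin p → VField M}
    (hV : ∀ i, (V i).Smooth) :
    MDifferentiableAt (𝓡 4) 𝓘(ℝ, ℝ) (fun z => w z (fun i => V i z)) x := by
  apply mdifferentiableAt_of_chart
  refine DifferentiableAt.congr_of_eventuallyEq ?_ (w.apply_comp_symm_eventuallyEq x V)
  have hV' := fun i => ((hV i).contDiffAt_inChart x).differentiableAt (by simp)
  exact (hw.hasFDerivAt.continuousAlternatingMap_apply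
    (fun i => (hV' i).hasFDerivAt)).differentiableAt

/-- The invariant formula for the exterior derivative. -/
theorem DForm.d_apply {n : ℕ} {w : DForm M (n + 1)} {x : M}
    (hw : DifferentiableAt ℝ (w.inChart x) (extChartAt (𝓡 4) x x)) {V : Fin (n + 2) → VField M}
    (hV : ∀ i, (V i).Smooth) :
    w.d x (fun i => V i x) =
      (∑ i : Fin (n + 2), (-1) ^ i.val *
        dirDeriv (fun z => w z (i.removeNth (fun j => V j z))) x (V i x)) -
      ∑ i : Fin (n + 1), ∑ j ≥ i, (-1) ^ (i + j : ℕ) *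
        w x (Matrix.vecCons (mlieBracket (𝓡 4) (V i.castSucc) (V j.succ) x)
          (j.removeNth (i.castSucc.removeNth (fun k => V k x)))) := by
  have : IsManifold (𝓡 4) 1 M := IsManifold.of_le (n := ∞) (by norm_num)
  have hV' := fun i => ((hV i).contDiffAt_inChart x).differentiableAt (by simp)
  -- The formula in Euclidean space, applied to the chart expressions. The rest carries each term
  -- back to `M`, at the base point where the chart derivative is the identity.
  have key := extDeriv_apply_vectorField hw hV'
  have h0 : w.d x (fun i => V i x) = extDeriv (w.inChart x) (extChartAt (𝓡 4) x x)
      (fun i => (V i).inChart x (extChartAt (𝓡 4) x x)) := by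
    change extDeriv (w.inChart x) _ (fun i => mfderiv _ _ _ x (V i x)) = _
    congr 1
    funext i
    rw [mfderiv_extChartAt_self]
    exact ((V i).inChart_self x).symm
  rw [h0, key]
  congr 1
  · refine Finset.sum_congr rfl fun i _ => ?_
    refine (neg_one_pow_zsmul_eq_mul _ _).trans (congrArg _ ?_)
    refine Eq.trans ?_ (dirDeriv_eq_fderiv
      (DForm.mdifferentiableAt_apply (V := fun j => V (i.succAbove j)) hw (fun j => hV _)) _).symm
    rw [(V i).inChart_self x]
    refine congrArg (fun L : EuclideanSpace ℝ (Fin 4) →L[ℝ] ℝ => L (V i x))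
      (Filter.EventuallyEq.fderiv_eq ?_)
    exact (w.apply_comp_symm_eventuallyEq x (fun j => V (i.succAbove j))).symm
  · refine Finset.sum_congr rfl fun i _ => Finset.sum_congr rfl fun j _ => ?_
    refine (neg_one_pow_zsmul_eq_mul _ _).trans (congrArg _ ?_)
    rw [w.inChart_self, mlieBracket_eq]
    congr 1
    refine congrArg _ ?_
    funext k
    exact (V (i.castSucc.succAbove (j.succAbove k))).inChart_self x

omit [IsManifold (𝓡 4) ∞ M] in
theorem DForm.Smooth.contDiffAt_inChart {p : ℕ} {w : DForm M p} (hw : w.Smooth) (x : M) :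
    ContDiffAt ℝ ∞ (w.inChart x) (extChartAt (𝓡 4) x x) :=
  (hw x).contDiffAt (extChartAt_target_mem_nhds (I := 𝓡 4) x)

/-- Smoothness of real functions on `M`. -/
abbrev SmoothFun (f : M → ℝ) : Prop := ContMDiff (𝓡 4) 𝓘(ℝ, ℝ) ∞ f

omit [IsManifold (𝓡 4) ∞ M] in
theorem SmoothFun.mdifferentiableAt {f : M → ℝ} (hf : SmoothFun f) (x : M) :
    MDifferentiableAt (𝓡 4) 𝓘(ℝ, ℝ) f x :=
  (hf x).mdifferentiableAt (by simp)

theorem DForm.Smooth.apply_smooth {w : DForm M 1} (hw : w.Smooth) {X : VField M}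
    (hX : X.Smooth) : SmoothFun (fun z => w z (fun _ => X z)) := by
  intro x
  apply contMDiffAt_of_chart
  refine ContDiffAt.congr_of_eventuallyEq ?_ (w.apply_comp_symm_eventuallyEq x (fun _ => X))
  have h1 := hw.contDiffAt_inChart x
  have h2 := hX.contDiffAt_inChart x
  -- Alternating 1-forms are identified with continuous linear maps, so that the evaluation rule for
  -- smooth families of linear maps applies.
  have h3 : ContDiffAt ℝ ∞ (fun y => (ContinuousAlternatingMap.ofSubsingletonLIE (𝕜 := ℝ)
    (E := EuclideanSpace ℝ (Fin 4)) (F := ℝ) (0 : Fin 1)).symm (w.inChart x y))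
      (extChartAt (𝓡 4) x x) :=
    (LinearIsometryEquiv.contDiff _).contDiffAt.comp _ h1
  exact h3.clm_apply h2

theorem VField.Smooth.mlieBracket {X Y : VField M} (hX : X.Smooth) (hY : Y.Smooth) :
    VField.Smooth (fun x => mlieBracket (𝓡 4) X Y x) := by
  -- The bracket costs one derivative, which is harmless since ∞ + 1 = ∞.
  have : IsManifold (𝓡 4) ((∞ : ℕ∞ω) + 1) M := by simpa using ‹IsManifold (𝓡 4) ∞ M›
  have : IsManifold (𝓡 4) (minSmoothness ℝ 2) M := by
    rw [minSmoothness_of_isRCLikeNormedField]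
    exact IsManifold.of_le (n := ∞) (WithTop.coe_le_coe.2 (le_top : (2 : ℕ∞) ≤ ⊤))
  exact fun x => ContMDiffAt.mlieBracket_vectorField (m := ⊤) (n := ⊤) (hX x) (hY x) (by simp)

end Chart
end GravForce

/-! ### Levi-Civita symbol and wedge products evaluated on vectors. -/

namespace GravForce

open VectorField Topology

/-- The Levi-Civita symbol. -/
def leviCivita (s : Fin 4 → Fin 4) : ℤ :=
  (((s 1 : ℤ) - s 0) * ((s 2 : ℤ) - s 0) * ((s 3 : ℤ) - s 0) * ((s 2 : ℤ) - s 1) *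
    ((s 3 : ℤ) - s 1) * ((s 3 : ℤ) - s 2)) / 12

/-- The symbol is a Vandermonde product; at 0, 1, 2, 3 that product equals 12, which explains the
denominator, and permuting its arguments multiplies it by the sign. -/
theorem leviCivita_perm : ∀ σ : Equiv.Perm (Fin 4), leviCivita σ = Equiv.Perm.sign σ := by
  decide

theorem leviCivita_of_eq {s : Fin 4 → Fin 4} {i j : Fin 4} (h : s i = s j) (hij : i ≠ j) :
    leviCivita s = 0 := by
  unfold leviCivita
  fin_cases i <;> fin_cases j <;> simp_all

/-- Each of the 24 permutations contributes the product of all four η's, which is -1. This is the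
Lorentzian sign in ⋆⋆ on 4-forms. -/
theorem sum_leviCivita_sq :
    ∑ a : Fin 4, ∑ b : Fin 4, ∑ c : Fin 4, ∑ d : Fin 4,
      (if a = 0 then -1 else 1) * (if b = 0 then -1 else 1) * (if c = 0 then -1 else 1) *
      (if d = 0 then -1 else 1) * leviCivita ![a, b, c, d] ^ 2 = -24 := by
  decide +kernel

section Frame

variable {V : Type*} [AddCommGroup V] [Module ℝ V] [TopologicalSpace V]

theorem top_form_apply (w : V [⋀^Fin 4]→L[ℝ] ℝ) (e : Fin 4 → V) (s : Fin 4 → Fin 4) :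
    w (fun i => e (s i)) = leviCivita s * w e := by
  by_cases hs : Function.Injective s
  · have hb := Finite.injective_iff_bijective.1 hs
    have h := w.toAlternatingMap.map_perm e (Equiv.ofBijective s hb)
    have h2 := leviCivita_perm (Equiv.ofBijective s hb)
    have h3 : ⇑(Equiv.ofBijective s hb) = s := rfl
    rw [h3] at h2
    rw [h2]
    refine h.trans ?_
    rw [Units.smul_def, zsmul_eq_mul]
    rfl
  · simp only [Function.Injective, not_forall] at hs
    obtain ⟨i, j, h, hij⟩ := hs
    rw [leviCivita_of_eq h hij, w.map_eq_zero_of_eq _ (by simp [h]) hij]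
    simp

theorem sum_fun_fin_succ {n : ℕ} (f : (Fin (n + 1) → Fin 4) → ℝ) :
    ∑ a, f a = ∑ k, ∑ a : Fin n → Fin 4, f (Matrix.vecCons k a) := by
  rw [← (Fin.consEquiv (fun _ : Fin (n + 1) => Fin 4)).sum_comp, Fintype.sum_prod_type]
  rfl

theorem sum_fun_fin_zero (f : (Fin 0 → Fin 4) → ℝ) : ∑ a, f a = f ![] := by
  rw [Fintype.sum_unique]
  congr 1

theorem wedgeAt_apply {p q : ℕ} (w : V [⋀^Fin p]→L[ℝ] ℝ) (η : V [⋀^Fin q]→L[ℝ] ℝ)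
    (v : Fin (p + q) → V) :
    wedgeAt w η v = ((p.factorial : ℝ) * (q.factorial : ℝ))⁻¹ *
      ∑ σ : Equiv.Perm (Fin (p + q)), ((Equiv.Perm.sign σ : ℤ) : ℝ) *
        (w (fun i => v (σ (Fin.castAdd q i))) * η (fun j => v (σ (Fin.natAdd p j)))) := by
  unfold wedgeAt
  rw [ContinuousAlternatingMap.smul_apply, smul_eq_mul,
    ContinuousMultilinearMap.alternatization_apply_apply]
  congr 1
  refine Finset.sum_congr rfl fun σ _ => ?_
  rw [Units.smul_def, zsmul_eq_mul]
  rfl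

theorem sum_perm_fin_two (f : Equiv.Perm (Fin 2) → ℝ) :
    ∑ σ, f σ = f 1 + f (Equiv.swap 0 1) := by
  have h : (Finset.univ : Finset (Equiv.Perm (Fin 2))) = {1, Equiv.swap 0 1} := by decide
  rw [h, Finset.sum_pair (by decide)]

theorem sum_perm_fin_three (f : Equiv.Perm (Fin 3) → ℝ) :
    ∑ σ, f σ = f 1 + f (Equiv.swap 0 1) + f (Equiv.swap 0 2) + f (Equiv.swap 1 2) +
      f (Equiv.swap 0 1 * Equiv.swap 1 2) + f (Equiv.swap 1 2 * Equiv.swap 0 1) := by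
  have h : (Finset.univ : Finset (Equiv.Perm (Fin 3))) =
      {1, Equiv.swap 0 1, Equiv.swap 0 2, Equiv.swap 1 2, Equiv.swap 0 1 * Equiv.swap 1 2,
        Equiv.swap 1 2 * Equiv.swap 0 1} := by decide
  rw [h, Finset.sum_insert (by decide), Finset.sum_insert (by decide),
    Finset.sum_insert (by decide), Finset.sum_insert (by decide), Finset.sum_pair (by decide)]
  ring

/-- The six listed permutations are the stabiliser of 3, a copy of the symmetric group on three
letters. -/
theorem sum_perm_fin_four (f : Equiv.Perm (Fin 4) → ℝ) (hf : ∀ σ, σ 3 ≠ 3 → f σ = 0) :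
    ∑ σ, f σ = f 1 + f (Equiv.swap 0 1) + f (Equiv.swap 0 2) + f (Equiv.swap 1 2) +
      f (Equiv.swap 0 1 * Equiv.swap 1 2) + f (Equiv.swap 1 2 * Equiv.swap 0 1) := by
  have h : (Finset.univ.filter fun σ : Equiv.Perm (Fin 4) => σ 3 = 3) =
      {1, Equiv.swap 0 1, Equiv.swap 0 2, Equiv.swap 1 2, Equiv.swap 0 1 * Equiv.swap 1 2,
        Equiv.swap 1 2 * Equiv.swap 0 1} := by decide
  rw [← Finset.sum_filter_of_ne (p := fun σ => σ 3 = 3) (fun σ _ hσ => not_imp_comm.1 (hf σ) hσ),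
    h, Finset.sum_insert (by decide), Finset.sum_insert (by decide),
    Finset.sum_insert (by decide), Finset.sum_insert (by decide), Finset.sum_pair (by decide)]
  ring

theorem two_form_swap (w : V [⋀^Fin 2]→L[ℝ] ℝ) (a b : V) : w ![b, a] = -w ![a, b] := by
  have h := w.toAlternatingMap.map_swap ![a, b] (i := 0) (j := 1) (by decide)
  have e : (![a, b] ∘ Equiv.swap (0 : Fin 2) 1) = ![b, a] := by
    funext i; fin_cases i <;> rfl
  rw [e] at h
  exact h

theorem two_form_self (w : V [⋀^Fin 2]→L[ℝ] ℝ) (a : V) : w ![a, a] = 0 :=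
  w.map_eq_zero_of_eq _ (i := 0) (j := 1) rfl (by decide)

theorem three_form_swap (w : V [⋀^Fin 3]→L[ℝ] ℝ) (a b c : V) :
    w ![b, a, c] = -w ![a, b, c] ∧ w ![c, b, a] = -w ![a, b, c] ∧
      w ![a, c, b] = -w ![a, b, c] := by
  have h1 := w.toAlternatingMap.map_swap ![a, b, c] (i := 0) (j := 1) (by decide)
  have h2 := w.toAlternatingMap.map_swap ![a, b, c] (i := 0) (j := 2) (by decide)
  have h3 := w.toAlternatingMap.map_swap ![a, b, c] (i := 1) (j := 2) (by decide)
  have e1 : (![a, b, c] ∘ Equiv.swap (0 : Fin 3) 1) = ![b, a, c] := by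
    funext i; fin_cases i <;> rfl
  have e2 : (![a, b, c] ∘ Equiv.swap (0 : Fin 3) 2) = ![c, b, a] := by
    funext i; fin_cases i <;> rfl
  have e3 : (![a, b, c] ∘ Equiv.swap (1 : Fin 3) 2) = ![a, c, b] := by
    funext i; fin_cases i <;> rfl
  rw [e1] at h1
  rw [e2] at h2
  rw [e3] at h3
  exact ⟨h1, h2, h3⟩

theorem three_form_cycle (w : V [⋀^Fin 3]→L[ℝ] ℝ) (a b c : V) :
    w ![b, c, a] = w ![a, b, c] ∧ w ![c, a, b] = w ![a, b, c] := by
  have h1 := (three_form_swap w a b c).1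
  have h2 := (three_form_swap w b a c).2.2
  have h3 := (three_form_swap w a c b).1
  have h4 := (three_form_swap w a b c).2.2
  constructor <;> linarith

theorem three_form_self (w : V [⋀^Fin 3]→L[ℝ] ℝ) (a b : V) :
    w ![a, a, b] = 0 ∧ w ![a, b, a] = 0 ∧ w ![b, a, a] = 0 :=
  ⟨w.map_eq_zero_of_eq _ (i := 0) (j := 1) rfl (by decide),
    w.map_eq_zero_of_eq _ (i := 0) (j := 2) rfl (by decide),
    w.map_eq_zero_of_eq _ (i := 1) (j := 2) rfl (by decide)⟩

theorem wedgeAt_one_one (w : V [⋀^Fin 1]→L[ℝ] ℝ) (η : V [⋀^Fin 1]→L[ℝ] ℝ) (a b : V) :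
    wedgeAt w η ![a, b] = w ![a] * η ![b] - w ![b] * η ![a] := by
  have hs : ∀ (σ : Equiv.Perm (Fin 2)),
      ((fun i : Fin 1 => ![a, b] (σ (Fin.castAdd 1 i))) = ![![a, b] (σ 0)]) ∧
      ((fun i : Fin 1 => ![a, b] (σ (Fin.natAdd 1 i))) = ![![a, b] (σ 1)]) := fun σ =>
    ⟨by funext i; fin_cases i; rfl, by funext i; fin_cases i; rfl⟩
  rw [wedgeAt_apply, sum_perm_fin_two]
  simp only [hs]
  simp
  ring

theorem wedgeAt_two_one (w : V [⋀^Fin 2]→L[ℝ] ℝ) (η : V [⋀^Fin 1]→L[ℝ] ℝ) (a b c : V) :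
    wedgeAt w η ![a, b, c] = w ![a, b] * η ![c] - w ![a, c] * η ![b] + w ![b, c] * η ![a] := by
  have hs : ∀ (σ : Equiv.Perm (Fin 3)),
      ((fun i : Fin 2 => ![a, b, c] (σ (Fin.castAdd 1 i))) =
        ![![a, b, c] (σ 0), ![a, b, c] (σ 1)]) ∧
      ((fun i : Fin 1 => ![a, b, c] (σ (Fin.natAdd 2 i))) = ![![a, b, c] (σ 2)]) := fun σ =>
    ⟨by funext i; fin_cases i <;> rfl, by funext i; fin_cases i; rfl⟩
  rw [wedgeAt_apply, sum_perm_fin_three]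
  simp only [hs]
  simp [Equiv.swap_apply_def]
  have h1 := two_form_swap w a b
  have h2 := two_form_swap w a c
  have h3 := two_form_swap w b c
  rw [h1, h2, h3]
  ring

theorem wedgeAt_one_two (w : V [⋀^Fin 1]→L[ℝ] ℝ) (η : V [⋀^Fin 2]→L[ℝ] ℝ) (a b c : V) :
    wedgeAt w η ![a, b, c] = w ![a] * η ![b, c] - w ![b] * η ![a, c] + w ![c] * η ![a, b] := by
  have hs : ∀ (σ : Equiv.Perm (Fin 3)),
      ((fun i : Fin 1 => ![a, b, c] (σ (Fin.castAdd 2 i))) = ![![a, b, c] (σ 0)]) ∧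
      ((fun i : Fin 2 => ![a, b, c] (σ (Fin.natAdd 1 i))) =
        ![![a, b, c] (σ 1), ![a, b, c] (σ 2)]) := fun σ =>
    ⟨by funext i; fin_cases i; rfl, by funext i; fin_cases i <;> rfl⟩
  rw [wedgeAt_apply, sum_perm_fin_three]
  simp only [hs]
  simp [Equiv.swap_apply_def]
  have h1 := two_form_swap η a b
  have h2 := two_form_swap η a c
  have h3 := two_form_swap η b c
  rw [h1, h2, h3]
  ring

/-- Since `η` kills the first three vectors, only permutations keeping the last slot survive. This
special case is all that normalising the volume form on the dual base requires. -/
theorem wedgeAt_three_one (w : V [⋀^Fin 3]→L[ℝ] ℝ) (η : V [⋀^Fin 1]→L[ℝ] ℝ) (a b c d : V)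
    (ha : η ![a] = 0) (hb : η ![b] = 0) (hc : η ![c] = 0) :
    wedgeAt w η ![a, b, c, d] = w ![a, b, c] * η ![d] := by
  have hs : ∀ (σ : Equiv.Perm (Fin 4)),
      ((fun i : Fin 3 => ![a, b, c, d] (σ (Fin.castAdd 1 i))) =
        ![![a, b, c, d] (σ 0), ![a, b, c, d] (σ 1), ![a, b, c, d] (σ 2)]) ∧
      ((fun i : Fin 1 => ![a, b, c, d] (σ (Fin.natAdd 3 i))) = ![![a, b, c, d] (σ 3)]) := fun σ =>
    ⟨by funext i; fin_cases i <;> rfl, by funext i; fin_cases i; rfl⟩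
  rw [wedgeAt_apply]
  simp only [hs]
  rw [sum_perm_fin_four]
  · simp [Equiv.swap_apply_def]
    obtain ⟨h1, h2, h3⟩ := three_form_swap w a b c
    obtain ⟨h4, h5⟩ := three_form_cycle w a b c
    rw [h1, h2, h3, h4, h5]
    norm_num [Nat.factorial]
    ring
  · intro σ hσ
    have : η ![![a, b, c, d] (σ 3)] = 0 := by
      generalize σ 3 = k at hσ ⊢
      fin_cases k <;> simp_all
    rw [this, mul_zero, mul_zero]

end Frame
end GravForce

/-! ### Components in the base field and the Hodge dual. -/

namespace GravForce

open VectorField Topology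

namespace Cobase

variable {M : Type*} [TopologicalSpace M] [ChartedSpace (EuclideanSpace ℝ (Fin 4)) M]
  [IsManifold (𝓡 4) ∞ M] (g : Cobase M)

/-- The components of a form in the base field. -/
noncomputable def comp {p : ℕ} (w : DForm M p) (a : Fin p → Fin 4) : M → ℝ :=
  fun x => w x (fun i => g.base (a i) x)

theorem form_base (α β : Fin 4) (x : M) :
    g.form α x ![g.base β x] = if α = β then 1 else 0 := by
  have e : ![g.base β x] = fun _ : Fin 1 => g.base β x := by
    funext i; fin_cases i; rfl
  rw [e, g.dual]

/-- Every tangent vector is the sum of its components in the base field. -/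
theorem sum_coord_smul_base (x : M) (v : TangentSpace (𝓡 4) x) :
    ∑ k, g.form k x (fun _ => v) • g.base k x = v := by
  classical
  have hadd : ∀ k (u v : TangentSpace (𝓡 4) x), g.form k x (fun _ => u + v) =
      g.form k x (fun _ => u) + g.form k x (fun _ => v) := by
    intro k u v
    have h := (g.form k x).map_update_add (fun _ => 0) 0 u v
    simp only [Function.update_eq_const_of_subsingleton] at h
    exact h
  have hsmul : ∀ k (c : ℝ) (u : TangentSpace (𝓡 4) x), g.form k x (fun _ => c • u) =
      c * g.form k x (fun _ => u) := by
    intro k c u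
    have h := (g.form k x).map_update_smul (fun _ => 0) 0 c u
    simp only [Function.update_eq_const_of_subsingleton, smul_eq_mul] at h
    exact h
  let L : TangentSpace (𝓡 4) x →ₗ[ℝ] (Fin 4 → ℝ) :=
    { toFun := fun v k => g.form k x (fun _ => v)
      map_add' := fun u v => funext fun k => hadd k u v
      map_smul' := fun c u => funext fun k => hsmul k c u }
  let R : (Fin 4 → ℝ) →ₗ[ℝ] TangentSpace (𝓡 4) x :=
    Fintype.linearCombination ℝ (fun k => g.base k x)
  have hLR : ∀ c, L (R c) = c := by
    intro c
    have hE : ∀ k, L (g.base k x) = Pi.single k 1 := by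
      intro k
      funext j
      change g.form j x (fun _ => g.base k x) = _
      rw [g.dual, Pi.single_apply]
    simp only [R, Fintype.linearCombination_apply, map_sum, map_smul, hE]
    funext j
    simp [Finset.sum_apply, Pi.single_apply]
  have hfin : Module.finrank ℝ (TangentSpace (𝓡 4) x) = 4 :=
    finrank_euclideanSpace_fin (𝕜 := ℝ) (n := 4)
  have : FiniteDimensional ℝ (TangentSpace (𝓡 4) x) :=
    inferInstanceAs (FiniteDimensional ℝ (EuclideanSpace ℝ (Fin 4)))
  -- Duality makes `R` a right inverse of `L`. Both spaces have dimension 4, so `L` is also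
  -- injective, and it is enough to compare the two sides after applying `L`.
  have hsurj : Function.Surjective L := fun c => ⟨R c, hLR c⟩
  have hinj : Function.Injective L :=
    (LinearMap.injective_iff_surjective_of_finrank_eq_finrank (by rw [hfin]; simp)).2 hsurj
  apply hinj
  exact hLR (L v)

theorem apply_vecCons {n : ℕ} (w : DForm M (n + 1)) (x : M) (v : TangentSpace (𝓡 4) x)
    (u : Fin n → TangentSpace (𝓡 4) x) :
    w x (Matrix.vecCons v u) =
      ∑ k, g.form k x (fun _ => v) * w x (Matrix.vecCons (g.base k x) u) := by
  let L : TangentSpace (𝓡 4) x →ₗ[ℝ] ℝ :=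
    { toFun := fun z => w x (Matrix.vecCons z u)
      map_add' := fun y z => (w x).cons_add u y z
      map_smul' := fun c z => (w x).cons_smul u c z }
  have h : L v = ∑ k, g.form k x (fun _ => v) * L (g.base k x) := by
    conv_lhs => rw [← g.sum_coord_smul_base x v, map_sum]
    simp only [map_smul, smul_eq_mul]
  exact h

theorem apply_eq_sum_comp {p : ℕ} (w : DForm M p) (x : M) (v : Fin p → TangentSpace (𝓡 4) x) :
    w x v = ∑ a : Fin p → Fin 4, (∏ i, g.form (a i) x (fun _ => v i)) * g.comp w a x := by
  conv_lhs => rw [show v = fun i => ∑ k, g.form k x (fun _ => v i) • g.base k x from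
    funext fun i => (g.sum_coord_smul_base x (v i)).symm]
  refine (MultilinearMap.map_sum (w x).toMultilinearMap _).trans ?_
  refine Finset.sum_congr rfl fun a _ => ?_
  exact MultilinearMap.map_smul_univ (w x).toMultilinearMap _ _

theorem volume_base (x : M) : g.volume x (fun i => g.base i x) = 1 := by
  have e : (fun i => g.base i x) = ![g.base 0 x, g.base 1 x, g.base 2 x, g.base 3 x] := by
    funext i; fin_cases i <;> rfl
  rw [e]
  unfold volume DForm.wedge
  rw [wedgeAt_three_one _ _ _ _ _ _ (by simp [form_base]) (by simp [form_base])
    (by simp [form_base]), wedgeAt_two_one, wedgeAt_one_one]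
  simp [form_base]

/-- The volume form is 1 on the base, so on any list of base vectors it is the Levi-Civita symbol of
their indices. -/
theorem comp_hodge {p q : ℕ} (h : p + q = 4) (w : DForm M p) (b : Fin q → Fin 4) (x : M) :
    g.comp (g.hodge h w) b x = (p.factorial : ℝ)⁻¹ * ∑ a : Fin p → Fin 4,
      (∏ i, eta (a i)) * g.comp w a x *
        (leviCivita (fun k => Fin.append a b (Fin.cast h.symm k)) : ℝ) := by
  unfold comp hodge
  rw [ContinuousAlternatingMap.smul_apply, smul_eq_mul, ContinuousAlternatingMap.sum_apply]
  congr 1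
  refine Finset.sum_congr rfl fun a _ => ?_
  rw [ContinuousAlternatingMap.smul_apply, smul_eq_mul]
  congr 1
  have e : insertFirst h (fun i => g.base (a i) x) (g.volume x) (fun i => g.base (b i) x) =
      g.volume x (fun k => g.base (Fin.append a b (Fin.cast h.symm k)) x) := by
    change g.volume x _ = _
    congr 1
    funext k
    generalize Fin.cast h.symm k = l
    refine Fin.addCases (fun i => ?_) (fun i => ?_) l <;> simp
  rw [e, top_form_apply (g.volume x) (fun i => g.base i x), volume_base, mul_one]

end Cobase
end GravForce

/-! ### Structure functions and the exterior derivative in the base field. -/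

namespace GravForce

open VectorField Topology

namespace Cobase

variable {M : Type*} [TopologicalSpace M] [ChartedSpace (EuclideanSpace ℝ (Fin 4)) M]
  [IsManifold (𝓡 4) ∞ M] (g : Cobase M)

/-- Chart components are polynomials in the frame components of `w` and the chart components of the
smooth g^c. This lets the formula for d be applied to forms such as ⋆dg^β, which are controlled only
through their frame components. -/
theorem differentiableAt_inChart {p : ℕ} {w : DForm M p} {x : M}
    (hw : ∀ a, MDifferentiableAt (𝓡 4) 𝓘(ℝ, ℝ) (g.comp w a) x) :
    DifferentiableAt ℝ (w.inChart x) (extChartAt (𝓡 4) x x) := by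
  let b := (EuclideanSpace.basisFun (Fin 4) ℝ).toBasis
  let ev : (EuclideanSpace ℝ (Fin 4) [⋀^Fin p]→L[ℝ] ℝ) →ₗ[ℝ] ((Fin p → Fin 4) → ℝ) :=
    { toFun := fun f a => f (fun i => b (a i))
      map_add' := fun _ _ => rfl
      map_smul' := fun _ _ => rfl }
  have hev : LinearMap.ker ev = ⊥ := by
    rw [LinearMap.ker_eq_bot]
    intro f f' h
    apply ContinuousAlternatingMap.toAlternatingMap_injective
    exact Module.Basis.ext_alternating b fun a _ => congrFun h a
  -- A form is determined by its values on a basis, so a linear left inverse of the evaluation map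
  -- recovers it from them; it is continuous because the target of evaluation is finite-dimensional.
  obtain ⟨P, hP⟩ := LinearMap.exists_leftInverse_of_injective ev hev
  have h1 : w.inChart x = fun y => P.toContinuousLinearMap (ev (w.inChart x y)) := by
    funext y
    exact (LinearMap.congr_fun hP _).symm
  rw [h1]
  refine P.toContinuousLinearMap.differentiableAt.comp _ (differentiableAt_pi.2 fun a => ?_)
  have h2 : (fun y => ev (w.inChart x y) a) =ᶠ[𝓝 (extChartAt (𝓡 4) x x)]
      fun y => ∑ c : Fin p → Fin 4, (∏ i, (g.form (c i)).inChart x y (fun _ => b (a i))) *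
        (g.comp w c ∘ (extChartAt (𝓡 4) x).symm) y :=
    Filter.Eventually.of_forall fun y => g.apply_eq_sum_comp w _ _
  refine DifferentiableAt.congr_of_eventuallyEq ?_ h2
  have h3 : ∀ c i, DifferentiableAt ℝ (fun y => (g.form c).inChart x y (fun _ => b (a i)))
      (extChartAt (𝓡 4) x x) := fun c i =>
    (((g.smooth_form c).contDiffAt_inChart x).differentiableAt
      (by simp)).hasFDerivAt.continuousAlternatingMap_apply_const _ |>.differentiableAt
  have h4 := fun c => differentiableAt_chart (hw c)
  refine DifferentiableAt.fun_sum fun c _ => DifferentiableAt.mul ?_ (h4 c)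
  exact (HasFDerivAt.finsetProd (𝕜 := ℝ) (u := Finset.univ)
    (g := fun i y => (g.form (c i)).inChart x y (fun _ => b (a i)))
    fun i _ => (h3 (c i) i).hasFDerivAt).differentiableAt

/-- The structure functions `c^k_{ab} = g^k([E_a, E_b])` of the base field. -/
noncomputable def struct (k a b : Fin 4) : M → ℝ := fun x =>
  g.form k x (fun _ => mlieBracket (𝓡 4) (g.base a) (g.base b) x)

/-- The invariant formula on base vectors, with each bracket [E_a, E_b] expanded in the base by
linearity in the first slot. -/
theorem comp_d {n : ℕ} {w : DForm M (n + 1)} {x : M}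
    (hw : ∀ a, MDifferentiableAt (𝓡 4) 𝓘(ℝ, ℝ) (g.comp w a) x) (a : Fin (n + 2) → Fin 4) :
    g.comp w.d a x =
      (∑ i : Fin (n + 2), (-1) ^ i.val *
        dirDeriv (g.comp w (i.removeNth a)) x (g.base (a i) x)) -
      ∑ i : Fin (n + 1), ∑ j ≥ i, (-1) ^ (i + j : ℕ) *
        ∑ k, g.struct k (a i.castSucc) (a j.succ) x *
          g.comp w (Matrix.vecCons k (j.removeNth (i.castSucc.removeNth a))) x := by
  unfold comp
  rw [DForm.d_apply (V := fun i => g.base (a i)) (g.differentiableAt_inChart hw)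
    (fun i => g.smooth_base _)]
  congr 1
  refine Finset.sum_congr rfl fun i _ => Finset.sum_congr rfl fun j _ => ?_
  rw [g.apply_vecCons]
  congr 1
  refine Finset.sum_congr rfl fun k _ => ?_
  unfold struct
  congr 2
  funext l
  refine Fin.cases rfl (fun l => rfl) l

end Cobase

/-! ### Calculus of directional derivatives. -/

section DirDeriv

variable {M : Type*} [TopologicalSpace M] [ChartedSpace (EuclideanSpace ℝ (Fin 4)) M]
  {f h : M → ℝ} {x : M}

/-- `f` is differentiable at `x`, with derivative `d` along `v`. -/
def HasDirDeriv (f : M → ℝ) (x : M) (v : TangentSpace (𝓡 4) x) (d : ℝ) : Prop :=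
  MDifferentiableAt (𝓡 4) 𝓘(ℝ, ℝ) f x ∧ dirDeriv f x v = d

namespace HasDirDeriv

variable {v : TangentSpace (𝓡 4) x} {d e : ℝ}

theorem of_mdifferentiableAt (hf : MDifferentiableAt (𝓡 4) 𝓘(ℝ, ℝ) f x)
    (v : TangentSpace (𝓡 4) x) : HasDirDeriv f x v (dirDeriv f x v) :=
  ⟨hf, rfl⟩

theorem congr (hf : HasDirDeriv f x v d) (h : d = e) : HasDirDeriv f x v e := h ▸ hf

theorem const (c : ℝ) : HasDirDeriv (fun _ : M => c) x v 0 := by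
  refine ⟨mdifferentiableAt_const, ?_⟩
  unfold dirDeriv
  rw [mfderiv_const]
  rfl

theorem add (hf : HasDirDeriv f x v d) (hh : HasDirDeriv h x v e) :
    HasDirDeriv (fun y => f y + h y) x v (d + e) := by
  refine ⟨hf.1.add hh.1, ?_⟩
  rw [← hf.2, ← hh.2]
  exact congrArg (fun L => L v) (hf.1.hasMFDerivAt.add hh.1.hasMFDerivAt).mfderiv

theorem mul (hf : HasDirDeriv f x v d) (hh : HasDirDeriv h x v e) :
    HasDirDeriv (fun y => f y * h y) x v (d * h x + f x * e) := by
  refine ⟨hf.1.mul hh.1, ?_⟩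
  rw [← hf.2, ← hh.2]
  refine (congrArg (fun L => L v) (hf.1.hasMFDerivAt.mul hh.1.hasMFDerivAt).mfderiv).trans ?_
  change f x * dirDeriv h x v + h x * dirDeriv f x v = _
  ring

theorem neg (hf : HasDirDeriv f x v d) : HasDirDeriv (fun y => -f y) x v (-d) := by
  simpa using (const (-1)).mul hf

theorem sub (hf : HasDirDeriv f x v d) (hh : HasDirDeriv h x v e) :
    HasDirDeriv (fun y => f y - h y) x v (d - e) := by
  simpa [sub_eq_add_neg] using hf.add hh.neg

theorem sum {ι : Type*} (s : Finset ι) {f : ι → M → ℝ} {d : ι → ℝ}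
    (hf : ∀ i, HasDirDeriv (f i) x v (d i)) :
    HasDirDeriv (fun y => ∑ i ∈ s, f i y) x v (∑ i ∈ s, d i) := by
  classical
  induction s using Finset.induction_on with
  | empty => simpa using const 0
  | insert i s hi ih => simpa [Finset.sum_insert hi] using (hf i).add ih

end HasDirDeriv

end DirDeriv
end GravForce

/-! ### Explicit formulas for d and ⋆ in each degree. -/

namespace GravForce

open VectorField Topology

theorem leviCivita_self (a b c : Fin 4) :
    leviCivita ![a, a, b, c] = 0 ∧ leviCivita ![a, b, a, c] = 0 ∧ leviCivita ![a, b, c, a] = 0 ∧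
    leviCivita ![b, a, a, c] = 0 ∧ leviCivita ![b, a, c, a] = 0 ∧ leviCivita ![b, c, a, a] = 0 :=
  ⟨leviCivita_of_eq (i := 0) (j := 1) rfl (by decide),
    leviCivita_of_eq (i := 0) (j := 2) rfl (by decide),
    leviCivita_of_eq (i := 0) (j := 3) rfl (by decide),
    leviCivita_of_eq (i := 1) (j := 2) rfl (by decide),
    leviCivita_of_eq (i := 1) (j := 3) rfl (by decide),
    leviCivita_of_eq (i := 2) (j := 3) rfl (by decide)⟩

theorem leviCivita_values :
    leviCivita ![0, 1, 2, 3] = 1 ∧ leviCivita ![0, 1, 3, 2] = -1 ∧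
    leviCivita ![0, 2, 1, 3] = -1 ∧ leviCivita ![0, 2, 3, 1] = 1 ∧
    leviCivita ![0, 3, 1, 2] = 1 ∧ leviCivita ![0, 3, 2, 1] = -1 ∧
    leviCivita ![1, 0, 2, 3] = -1 ∧ leviCivita ![1, 0, 3, 2] = 1 ∧
    leviCivita ![1, 2, 0, 3] = 1 ∧ leviCivita ![1, 2, 3, 0] = -1 ∧
    leviCivita ![1, 3, 0, 2] = -1 ∧ leviCivita ![1, 3, 2, 0] = 1 ∧
    leviCivita ![2, 0, 1, 3] = 1 ∧ leviCivita ![2, 0, 3, 1] = -1 ∧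
    leviCivita ![2, 1, 0, 3] = -1 ∧ leviCivita ![2, 1, 3, 0] = 1 ∧
    leviCivita ![2, 3, 0, 1] = 1 ∧ leviCivita ![2, 3, 1, 0] = -1 ∧
    leviCivita ![3, 0, 1, 2] = -1 ∧ leviCivita ![3, 0, 2, 1] = 1 ∧
    leviCivita ![3, 1, 0, 2] = 1 ∧ leviCivita ![3, 1, 2, 0] = -1 ∧
    leviCivita ![3, 2, 0, 1] = -1 ∧ leviCivita ![3, 2, 1, 0] = 1 := by
  decide

theorem eta_values : eta 0 = -1 ∧ eta 1 = 1 ∧ eta 2 = 1 ∧ eta 3 = 1 := by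
  simp [eta]

namespace Cobase

variable {M : Type*} [TopologicalSpace M] [ChartedSpace (EuclideanSpace ℝ (Fin 4)) M]
  [IsManifold (𝓡 4) ∞ M] (g : Cobase M)

theorem comp_d_one {w : DForm M 1} {x : M}
    (hw : ∀ a, MDifferentiableAt (𝓡 4) 𝓘(ℝ, ℝ) (g.comp w a) x) (a b : Fin 4) :
    g.comp w.d ![a, b] x = dirDeriv (g.comp w ![b]) x (g.base a x) -
      dirDeriv (g.comp w ![a]) x (g.base b x) - ∑ k, g.struct k a b x * g.comp w ![k] x := by
  have e0 : (0 : Fin 2).removeNth ![a, b] = ![b] := by funext i; fin_cases i; rfl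
  have e1 : (1 : Fin 2).removeNth ![a, b] = ![a] := by funext i; fin_cases i; rfl
  rw [g.comp_d hw, Fin.sum_univ_two, Fin.sum_univ_one, e0, e1]
  have h : Finset.Ici (0 : Fin 1) = {0} := by decide
  rw [h, Finset.sum_singleton]
  have f00 : (0 : Fin 1).removeNth ((Fin.castSucc (0 : Fin 1)).removeNth ![a, b]) = ![] :=
    Subsingleton.elim _ _
  rw [f00]
  simp
  ring

theorem comp_d_two {w : DForm M 2} {x : M}
    (hw : ∀ a, MDifferentiableAt (𝓡 4) 𝓘(ℝ, ℝ) (g.comp w a) x) (a b c : Fin 4) :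
    g.comp w.d ![a, b, c] x = dirDeriv (g.comp w ![b, c]) x (g.base a x) -
      dirDeriv (g.comp w ![a, c]) x (g.base b x) + dirDeriv (g.comp w ![a, b]) x (g.base c x) -
      ∑ k, g.struct k a b x * g.comp w ![k, c] x + ∑ k, g.struct k a c x * g.comp w ![k, b] x -
      ∑ k, g.struct k b c x * g.comp w ![k, a] x := by
  have e0 : (0 : Fin 3).removeNth ![a, b, c] = ![b, c] := by funext i; fin_cases i <;> rfl
  have e1 : (1 : Fin 3).removeNth ![a, b, c] = ![a, c] := by funext i; fin_cases i <;> rfl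
  have e2 : (2 : Fin 3).removeNth ![a, b, c] = ![a, b] := by funext i; fin_cases i <;> rfl
  rw [g.comp_d hw, Fin.sum_univ_three, Fin.sum_univ_two, e0, e1, e2]
  have h0 : Finset.Ici (0 : Fin 2) = {0, 1} := by decide
  have h1 : Finset.Ici (1 : Fin 2) = {1} := by decide
  rw [h0, h1, Finset.sum_singleton, Finset.sum_pair (by decide)]
  have f00 : (0 : Fin 2).removeNth ((Fin.castSucc (0 : Fin 2)).removeNth ![a, b, c]) = ![c] := by
    funext i; fin_cases i; rfl
  have f01 : (1 : Fin 2).removeNth ((Fin.castSucc (0 : Fin 2)).removeNth ![a, b, c]) = ![b] := by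
    funext i; fin_cases i; rfl
  have f11 : (1 : Fin 2).removeNth ((Fin.castSucc (1 : Fin 2)).removeNth ![a, b, c]) = ![a] := by
    funext i; fin_cases i; rfl
  rw [f00, f01, f11]
  simp
  ring

theorem comp_d_three {w : DForm M 3} {x : M}
    (hw : ∀ a, MDifferentiableAt (𝓡 4) 𝓘(ℝ, ℝ) (g.comp w a) x) (a b c d : Fin 4) :
    g.comp w.d ![a, b, c, d] x = dirDeriv (g.comp w ![b, c, d]) x (g.base a x) -
      dirDeriv (g.comp w ![a, c, d]) x (g.base b x) +
      dirDeriv (g.comp w ![a, b, d]) x (g.base c x) -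
      dirDeriv (g.comp w ![a, b, c]) x (g.base d x) -
      ∑ k, g.struct k a b x * g.comp w ![k, c, d] x +
      ∑ k, g.struct k a c x * g.comp w ![k, b, d] x -
      ∑ k, g.struct k a d x * g.comp w ![k, b, c] x -
      ∑ k, g.struct k b c x * g.comp w ![k, a, d] x +
      ∑ k, g.struct k b d x * g.comp w ![k, a, c] x -
      ∑ k, g.struct k c d x * g.comp w ![k, a, b] x := by
  have e0 : (0 : Fin 4).removeNth ![a, b, c, d] = ![b, c, d] := by
    funext i; fin_cases i <;> rfl
  have e1 : (1 : Fin 4).removeNth ![a, b, c, d] = ![a, c, d] := by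
    funext i; fin_cases i <;> rfl
  have e2 : (2 : Fin 4).removeNth ![a, b, c, d] = ![a, b, d] := by
    funext i; fin_cases i <;> rfl
  have e3 : (3 : Fin 4).removeNth ![a, b, c, d] = ![a, b, c] := by
    funext i; fin_cases i <;> rfl
  rw [g.comp_d hw, Fin.sum_univ_four, Fin.sum_univ_three, e0, e1, e2, e3]
  have h0 : Finset.Ici (0 : Fin 3) = {0, 1, 2} := by decide
  have h1 : Finset.Ici (1 : Fin 3) = {1, 2} := by decide
  have h2 : Finset.Ici (2 : Fin 3) = {2} := by decide
  rw [h0, h1, h2, Finset.sum_singleton, Finset.sum_pair (by decide),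
    Finset.sum_insert (by decide), Finset.sum_pair (by decide)]
  have f00 : (0 : Fin 3).removeNth ((Fin.castSucc (0 : Fin 3)).removeNth ![a, b, c, d]) =
    ![c, d] := by funext i; fin_cases i <;> rfl
  have f01 : (1 : Fin 3).removeNth ((Fin.castSucc (0 : Fin 3)).removeNth ![a, b, c, d]) =
    ![b, d] := by funext i; fin_cases i <;> rfl
  have f02 : (2 : Fin 3).removeNth ((Fin.castSucc (0 : Fin 3)).removeNth ![a, b, c, d]) =
    ![b, c] := by funext i; fin_cases i <;> rfl
  have f11 : (1 : Fin 3).removeNth ((Fin.castSucc (1 : Fin 3)).removeNth ![a, b, c, d]) =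
    ![a, d] := by funext i; fin_cases i <;> rfl
  have f12 : (2 : Fin 3).removeNth ((Fin.castSucc (1 : Fin 3)).removeNth ![a, b, c, d]) =
    ![a, c] := by funext i; fin_cases i <;> rfl
  have f22 : (2 : Fin 3).removeNth ((Fin.castSucc (2 : Fin 3)).removeNth ![a, b, c, d]) =
    ![a, b] := by funext i; fin_cases i <;> rfl
  rw [f00, f01, f02, f11, f12, f22]
  simp
  ring

theorem comp_two (w : DForm M 2) (a b : Fin 4) (x : M) :
    g.comp w ![a, b] x = w x ![g.base a x, g.base b x] := by
  unfold comp
  congr 1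
  funext i
  fin_cases i <;> rfl

theorem comp_three (w : DForm M 3) (a b c : Fin 4) (x : M) :
    g.comp w ![a, b, c] x = w x ![g.base a x, g.base b x, g.base c x] := by
  unfold comp
  congr 1
  funext i
  fin_cases i <;> rfl

theorem comp_two_swap (w : DForm M 2) (a b : Fin 4) (x : M) :
    g.comp w ![b, a] x = -g.comp w ![a, b] x := by
  simp only [comp_two, two_form_swap (w x) (g.base a x) (g.base b x)]

theorem comp_two_self (w : DForm M 2) (a : Fin 4) (x : M) : g.comp w ![a, a] x = 0 := by
  simp only [comp_two, two_form_self]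

theorem comp_three_swap (w : DForm M 3) (a b c : Fin 4) (x : M) :
    g.comp w ![b, a, c] x = -g.comp w ![a, b, c] x ∧
    g.comp w ![c, b, a] x = -g.comp w ![a, b, c] x ∧
    g.comp w ![a, c, b] x = -g.comp w ![a, b, c] x ∧
    g.comp w ![b, c, a] x = g.comp w ![a, b, c] x ∧
    g.comp w ![c, a, b] x = g.comp w ![a, b, c] x := by
  simp only [comp_three]
  obtain ⟨h1, h2, h3⟩ := three_form_swap (w x) (g.base a x) (g.base b x) (g.base c x)
  obtain ⟨h4, h5⟩ := three_form_cycle (w x) (g.base a x) (g.base b x) (g.base c x)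
  exact ⟨h1, h2, h3, h4, h5⟩

theorem comp_three_self (w : DForm M 3) (a b : Fin 4) (x : M) :
    g.comp w ![a, a, b] x = 0 ∧ g.comp w ![a, b, a] x = 0 ∧ g.comp w ![b, a, a] x = 0 := by
  simp only [comp_three]
  exact three_form_self (w x) (g.base a x) (g.base b x)

theorem comp_four (w : DForm M 4) (a b c d : Fin 4) (x : M) :
    g.comp w ![a, b, c, d] x = leviCivita ![a, b, c, d] * g.comp w ![0, 1, 2, 3] x := by
  have e : g.comp w ![0, 1, 2, 3] x = w x (fun i => g.base i x) := by
    unfold comp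
    congr 1
    funext i
    fin_cases i <;> rfl
  rw [e]
  exact top_form_apply (w x) (fun i => g.base i x) ![a, b, c, d]

theorem comp_hodge_one' (w : DForm M 1) (b c d : Fin 4) (x : M) :
    g.comp (g.hodge (p := 1) (q := 3) rfl w) ![b, c, d] x =
      ∑ a, eta a * g.comp w ![a] x * (leviCivita ![a, b, c, d] : ℝ) := by
  rw [comp_hodge]
  simp only [sum_fun_fin_succ, sum_fun_fin_zero]
  have e : ∀ a, (fun k => Fin.append ![a] ![b, c, d] (Fin.cast rfl k)) = ![a, b, c, d] := by
    intro a; funext k; fin_cases k <;> rfl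
  simp only [e]
  simp

theorem comp_hodge_two' (w : DForm M 2) (c d : Fin 4) (x : M) :
    g.comp (g.hodge (p := 2) (q := 2) rfl w) ![c, d] x =
      2⁻¹ * ∑ a, ∑ b, eta a * eta b * g.comp w ![a, b] x * (leviCivita ![a, b, c, d] : ℝ) := by
  rw [comp_hodge]
  simp only [sum_fun_fin_succ, sum_fun_fin_zero]
  have e : ∀ a b, (fun k => Fin.append ![a, b] ![c, d] (Fin.cast rfl k)) = ![a, b, c, d] := by
    intro a b; funext k; fin_cases k <;> rfl
  simp only [e]
  simp

theorem comp_hodge_three' (w : DForm M 3) (d : Fin 4) (x : M) :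
    g.comp (g.hodge (p := 3) (q := 1) rfl w) ![d] x =
      6⁻¹ * ∑ a, ∑ b, ∑ c, eta a * eta b * eta c * g.comp w ![a, b, c] x *
        (leviCivita ![a, b, c, d] : ℝ) := by
  rw [comp_hodge]
  simp only [sum_fun_fin_succ, sum_fun_fin_zero]
  have e : ∀ a b c, (fun k => Fin.append ![a, b, c] ![d] (Fin.cast rfl k)) = ![a, b, c, d] := by
    intro a b c; funext k; fin_cases k <;> rfl
  simp only [e]
  simp [Fin.prod_univ_three, Nat.factorial]

/-- The factor 1/4! cancels the 24 equal terms of the contraction, and the minus sign is the product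
of the four η's. -/
theorem comp_hodge_four (w : DForm M 4) (x : M) :
    g.comp (g.hodge (p := 4) (q := 0) rfl w) ![] x = -g.comp w ![0, 1, 2, 3] x := by
  rw [comp_hodge]
  simp only [sum_fun_fin_succ, sum_fun_fin_zero]
  have e : ∀ a b c d : Fin 4, (fun k => Fin.append ![a, b, c, d] ![] (Fin.cast rfl k)) =
      ![a, b, c, d] := by
    intro a b c d; funext k; fin_cases k <;> rfl
  have he : ∀ a, eta a = ((if a = 0 then -1 else 1 : ℤ) : ℝ) := by
    intro a
    unfold eta
    split_ifs <;> simp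
  have h : ∀ a b c d : Fin 4, (∏ i, eta (![a, b, c, d] i)) * g.comp w ![a, b, c, d] x *
      (leviCivita (fun k => Fin.append ![a, b, c, d] ![] (Fin.cast rfl k)) : ℝ) =
      (((if a = 0 then -1 else 1) * (if b = 0 then -1 else 1) * (if c = 0 then -1 else 1) *
      (if d = 0 then -1 else 1) * leviCivita ![a, b, c, d] ^ 2 : ℤ) : ℝ) *
        g.comp w ![0, 1, 2, 3] x := by
    intro a b c d
    rw [comp_four g w a b c d, e, Fin.prod_univ_four]
    change eta a * eta b * eta c * eta d * _ * _ = _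
    simp only [he, Int.cast_mul, Int.cast_pow]
    ring
  simp only [h, ← Finset.sum_mul, ← Int.cast_sum]
  rw [sum_leviCivita_sq]
  norm_num [Nat.factorial]
  ring

theorem comp_hodge_one (w : DForm M 1) (x : M) :
    g.comp (g.hodge (p := 1) (q := 3) rfl w) ![1, 2, 3] x = -g.comp w ![0] x ∧
    g.comp (g.hodge (p := 1) (q := 3) rfl w) ![0, 2, 3] x = -g.comp w ![1] x ∧
    g.comp (g.hodge (p := 1) (q := 3) rfl w) ![0, 1, 3] x = g.comp w ![2] x ∧
    g.comp (g.hodge (p := 1) (q := 3) rfl w) ![0, 1, 2] x = -g.comp w ![3] x := by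
  simp only [comp_hodge_one', Fin.sum_univ_four]
  simp only [leviCivita_self, leviCivita_values, eta_values, Int.cast_zero, Int.cast_one,
    Int.cast_neg, mul_zero, zero_add, add_zero]
  refine ⟨?_, ?_, ?_, ?_⟩ <;> ring

theorem comp_hodge_two (w : DForm M 2) (x : M) :
    g.comp (g.hodge (p := 2) (q := 2) rfl w) ![0, 1] x = g.comp w ![2, 3] x ∧
    g.comp (g.hodge (p := 2) (q := 2) rfl w) ![0, 2] x = -g.comp w ![1, 3] x ∧
    g.comp (g.hodge (p := 2) (q := 2) rfl w) ![0, 3] x = g.comp w ![1, 2] x ∧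
    g.comp (g.hodge (p := 2) (q := 2) rfl w) ![1, 2] x = -g.comp w ![0, 3] x ∧
    g.comp (g.hodge (p := 2) (q := 2) rfl w) ![1, 3] x = g.comp w ![0, 2] x ∧
    g.comp (g.hodge (p := 2) (q := 2) rfl w) ![2, 3] x = -g.comp w ![0, 1] x := by
  have h01 := g.comp_two_swap w 0 1 x
  have h02 := g.comp_two_swap w 0 2 x
  have h03 := g.comp_two_swap w 0 3 x
  have h12 := g.comp_two_swap w 1 2 x
  have h13 := g.comp_two_swap w 1 3 x
  have h23 := g.comp_two_swap w 2 3 x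
  simp only [comp_hodge_two', Fin.sum_univ_four, comp_two_self, h01, h02, h03, h12, h13, h23]
  simp only [leviCivita_self, leviCivita_values, eta_values, Int.cast_zero, Int.cast_one,
    Int.cast_neg, mul_zero, zero_add, add_zero]
  refine ⟨?_, ?_, ?_, ?_, ?_, ?_⟩ <;> ring

theorem comp_hodge_three (w : DForm M 3) (x : M) :
    g.comp (g.hodge (p := 3) (q := 1) rfl w) ![0] x = -g.comp w ![1, 2, 3] x ∧
    g.comp (g.hodge (p := 3) (q := 1) rfl w) ![1] x = -g.comp w ![0, 2, 3] x ∧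
    g.comp (g.hodge (p := 3) (q := 1) rfl w) ![2] x = g.comp w ![0, 1, 3] x ∧
    g.comp (g.hodge (p := 3) (q := 1) rfl w) ![3] x = -g.comp w ![0, 1, 2] x := by
  have h1 := g.comp_three_swap w 1 2 3 x
  have h2 := g.comp_three_swap w 0 2 3 x
  have h3 := g.comp_three_swap w 0 1 3 x
  have h4 := g.comp_three_swap w 0 1 2 x
  simp only [comp_hodge_three', Fin.sum_univ_four, comp_three_self, h1, h2, h3, h4]
  simp only [leviCivita_self, leviCivita_values, eta_values, Int.cast_zero, Int.cast_one,
    Int.cast_neg, mul_zero, zero_add, add_zero]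
  refine ⟨?_, ?_, ?_, ?_⟩ <;> ring

end Cobase
end GravForce

/-! ### Codifferentials in the base field and the structure equations. -/

namespace GravForce

open VectorField Topology

theorem one_form_add {V : Type*} [AddCommGroup V] [Module ℝ V] [TopologicalSpace V]
    (w : V [⋀^Fin 1]→L[ℝ] ℝ) (u v : V) :
    w (fun _ => u + v) = w (fun _ => u) + w (fun _ => v) := by
  have h := w.map_update_add (fun _ => 0) 0 u v
  simp only [Function.update_eq_const_of_subsingleton] at h
  exact h

theorem one_form_neg {V : Type*} [AddCommGroup V] [Module ℝ V] [TopologicalSpace V]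
    (w : V [⋀^Fin 1]→L[ℝ] ℝ) (u : V) : w (fun _ => -u) = -w (fun _ => u) := by
  have h := w.map_update_smul (fun _ => 0) 0 (-1) u
  simp only [Function.update_eq_const_of_subsingleton, neg_smul, one_smul] at h
  exact h

section

variable {M : Type*} [TopologicalSpace M] [ChartedSpace (EuclideanSpace ℝ (Fin 4)) M]
  [IsManifold (𝓡 4) ∞ M]

theorem DForm.d_one_apply {w : DForm M 1} (hw : w.Smooth) {X Y : VField M} (hX : X.Smooth)
    (hY : Y.Smooth) (x : M) :
    w.d x ![X x, Y x] = dirDeriv (fun z => w z (fun _ => Y z)) x (X x) -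
      dirDeriv (fun z => w z (fun _ => X z)) x (Y x) -
      w x (fun _ => mlieBracket (𝓡 4) X Y x) := by
  have h := DForm.d_apply (V := ![X, Y]) ((hw.contDiffAt_inChart x).differentiableAt (by simp))
    (fun i => by fin_cases i; exacts [hX, hY])
  have e : (fun i => ![X, Y] i x) = ![X x, Y x] := by funext i; fin_cases i <;> rfl
  have e0 : ∀ z, (0 : Fin 2).removeNth (fun j => ![X, Y] j z) = fun _ => Y z := by
    intro z; funext i; fin_cases i; rfl
  have e1 : ∀ z, (1 : Fin 2).removeNth (fun j => ![X, Y] j z) = fun _ => X z := by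
    intro z; funext i; fin_cases i; rfl
  have e2 : ∀ (v : TangentSpace (𝓡 4) x) (u : Fin 0 → TangentSpace (𝓡 4) x),
      Matrix.vecCons v u = fun _ => v := by
    intro v u; funext i; fin_cases i; rfl
  have hI : Finset.Ici (0 : Fin 1) = {0} := by decide
  rw [e, Fin.sum_univ_two, Fin.sum_univ_one, hI, Finset.sum_singleton,
    e2 (mlieBracket _ _ _ _)] at h
  simp only [e0, e1] at h
  rw [h]
  simp
  ring

end

namespace Cobase

variable {M : Type*} [TopologicalSpace M] [ChartedSpace (EuclideanSpace ℝ (Fin 4)) M]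
  [IsManifold (𝓡 4) ∞ M] (g : Cobase M)

theorem comp_one (w : DForm M 1) (a : Fin 4) (x : M) :
    g.comp w ![a] x = w x (fun _ => g.base a x) := by
  unfold comp
  congr 1
  funext i
  fin_cases i; rfl

theorem comp_form (β a : Fin 4) : g.comp (g.form β) ![a] = fun _ => if β = a then 1 else 0 := by
  funext x
  rw [comp_one, g.dual]

theorem comp_codiff {p q : ℕ} (h : p + 1 + q = 4) (w : DForm M (p + 1)) (a : Fin p → Fin 4)
    (x : M) : g.comp (g.codiff h w) a x =
      -g.comp (g.hodge (p := q + 1) (q := p) (by omega) (g.hodge h w).d) a x := rfl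

theorem toFun_eq_comp (f : DForm M 0) (x : M) : f.toFun x = g.comp f ![] x := by
  unfold DForm.toFun comp
  congr 1
  exact Subsingleton.elim _ _

theorem fin_one_eq (a : Fin 1 → Fin 4) : a = ![a 0] := by funext i; fin_cases i; rfl

theorem fin_two_eq (a : Fin 2 → Fin 4) : a = ![a 0, a 1] := by funext i; fin_cases i <;> rfl

theorem struct_swap (k a b : Fin 4) (x : M) : g.struct k b a x = -g.struct k a b x := by
  unfold struct
  rw [mlieBracket_swap_apply, one_form_neg]

theorem struct_self (k a : Fin 4) (x : M) : g.struct k a a x = 0 := by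
  have h := g.struct_swap k a a x
  linarith

theorem smooth_struct (k a b : Fin 4) : SmoothFun (g.struct k a b) :=
  (g.smooth_form k).apply_smooth ((g.smooth_base a).mlieBracket (g.smooth_base b))

/-- The components of g^β in its own dual base are constant, so only the bracket term of the formula
for d survives. -/
theorem comp_d_form (β a b : Fin 4) :
    g.comp (g.form β).d ![a, b] = fun x => -g.struct β a b x := by
  funext x
  have hc : ∀ (c : ℝ) (v : TangentSpace (𝓡 4) x), dirDeriv (fun _ : M => c) x v = 0 :=
    fun c v => (HasDirDeriv.const (v := v) c).2
  rw [comp_d_one]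
  · simp [comp_form, hc]
  · intro a
    rw [fin_one_eq a, comp_form]
    exact mdifferentiableAt_const

theorem mdifferentiableAt_comp_d_form (β : Fin 4) (a : Fin 2 → Fin 4) (x : M) :
    MDifferentiableAt (𝓡 4) 𝓘(ℝ, ℝ) (g.comp (g.form β).d a) x := by
  rw [fin_two_eq a, comp_d_form]
  exact (HasDirDeriv.of_mdifferentiableAt ((g.smooth_struct _ _ _).mdifferentiableAt x) 0).neg.1

theorem d_lower (β : Fin 4) : (g.lower β).d = eta β • (g.form β).d := by
  have hl : ∀ a, g.comp (g.lower β) ![a] = fun _ => eta β * if β = a then 1 else 0 := by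
    intro a
    funext x
    rw [comp_one]
    change eta β * g.form β x (fun _ => g.base a x) = _
    rw [g.dual]
  have hc : ∀ (x : M) (c : ℝ) (v : TangentSpace (𝓡 4) x), dirDeriv (fun _ : M => c) x v = 0 :=
    fun x c v => (HasDirDeriv.const (v := v) c).2
  have h : ∀ x a, g.comp (g.lower β).d a x = eta β * g.comp (g.form β).d a x := by
    intro x a
    rw [fin_two_eq a, comp_d_form, comp_d_one]
    · simp [hl, hc]
      ring
    · intro a
      rw [fin_one_eq a, hl]
      exact mdifferentiableAt_const
  funext x
  ext v
  change _ = eta β * (g.form β).d x v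
  rw [apply_eq_sum_comp g, apply_eq_sum_comp g, Finset.mul_sum]
  refine Finset.sum_congr rfl fun a _ => ?_
  rw [h]
  ring

theorem mdifferentiableAt_comp_hodge {p q : ℕ} (h : p + q = 4) {w : DForm M p} {x : M}
    (hw : ∀ a, MDifferentiableAt (𝓡 4) 𝓘(ℝ, ℝ) (g.comp w a) x) (b : Fin q → Fin 4) :
    MDifferentiableAt (𝓡 4) 𝓘(ℝ, ℝ) (g.comp (g.hodge h w) b) x := by
  rw [funext (g.comp_hodge h w b)]
  exact ((HasDirDeriv.const (v := 0) _).mul (HasDirDeriv.sum _ fun a =>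
    ((HasDirDeriv.const _).mul (.of_mdifferentiableAt (hw a) 0)).mul (.const _))).1

/-- The divergence of a `1`-form in the base field. -/
theorem codiffOne_eq {w : DForm M 1} {x : M} {D : Fin 4 → Fin 4 → ℝ}
    (hw : ∀ e a, HasDirDeriv (g.comp w ![a]) x (g.base e x) (D e a)) :
    g.codiffOne w x =
      ∑ a, eta a * (D a a + g.comp w ![a] x * ∑ b, g.struct b b a x) := by
  have hm : ∀ a, MDifferentiableAt (𝓡 4) 𝓘(ℝ, ℝ) (g.comp w a) x := by
    intro a
    rw [fin_one_eq a]
    exact (hw 0 _).1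
  -- The minus sign in δ = -⋆d⋆ cancels the one from ⋆ on 4-forms, so δ is the divergence on
  -- 1-forms.
  have h1 : g.codiffOne w x =
      g.comp (g.hodge (p := 1) (q := 3) rfl w).d ![0, 1, 2, 3] x := by
    have h : g.comp (g.codiff (p := 0) (q := 3) rfl w) ![] x = _ := g.comp_codiff rfl w ![] x
    have h3 : g.codiffOne w x = g.comp (g.codiff (p := 0) (q := 3) rfl w) ![] x :=
      g.toFun_eq_comp _ x
    rw [h3, h]
    exact (congrArg _ (g.comp_hodge_four (g.hodge (p := 1) (q := 3) rfl w).d x)).trans (neg_neg _)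
  obtain ⟨e0, e1, e2, e3⟩ := forall_and.1 (fun y => g.comp_hodge_one w y) |>.imp id
    fun h => (forall_and.1 h).imp id fun h => forall_and.1 h
  have d0 := fun e => (hw e 0).neg.2
  have d1 := fun e => (hw e 1).neg.2
  have d2 := fun e => (hw e 2).2
  have d3 := fun e => (hw e 3).neg.2
  rw [h1, g.comp_d_three (g.mdifferentiableAt_comp_hodge rfl hm), funext e0, funext e1, funext e2,
    funext e3, d0, d1, d2, d3]
  have t01 := fun k => g.struct_swap k 0 1 x
  have t02 := fun k => g.struct_swap k 0 2 x
  have t03 := fun k => g.struct_swap k 0 3 x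
  have t12 := fun k => g.struct_swap k 1 2 x
  have t13 := fun k => g.struct_swap k 1 3 x
  have t23 := fun k => g.struct_swap k 2 3 x
  have s0 := g.comp_three_swap (g.hodge (p := 1) (q := 3) rfl w) 1 2 3 x
  have s1 := g.comp_three_swap (g.hodge (p := 1) (q := 3) rfl w) 0 2 3 x
  have s2 := g.comp_three_swap (g.hodge (p := 1) (q := 3) rfl w) 0 1 3 x
  have s3 := g.comp_three_swap (g.hodge (p := 1) (q := 3) rfl w) 0 1 2 x
  simp only [Fin.sum_univ_four, comp_three_self, s0, s1, s2, s3, e0, e1, e2, e3, eta_values]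
  simp only [struct_self, t01, t02, t03, t12, t13, t23]
  ring

end Cobase

/-- The components of the Hodge dual of a `2`-form. -/
def starTwo (w : Fin 4 → Fin 4 → ℝ) : Fin 4 → Fin 4 → ℝ :=
  ![![0, w 2 3, -w 1 3, w 1 2], ![-w 2 3, 0, -w 0 3, w 0 2], ![w 1 3, w 0 3, 0, -w 0 1],
    ![-w 1 2, -w 0 2, w 0 1, 0]]

/-- The components of the exterior derivative of a `2`-form with components `w`, with derivatives
`D` along the base field, in terms of the structure functions `c`. -/
def dTwo (c : Fin 4 → Fin 4 → Fin 4 → ℝ) (w : Fin 4 → Fin 4 → ℝ)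
    (D : Fin 4 → Fin 4 → Fin 4 → ℝ) (i j k : Fin 4) : ℝ :=
  D i j k - D j i k + D k i j - ∑ l, c l i j * w l k + ∑ l, c l i k * w l j - ∑ l, c l j k * w l i

/-- The components of the codifferential of a `2`-form. -/
def codiffTwo (c : Fin 4 → Fin 4 → Fin 4 → ℝ) (w : Fin 4 → Fin 4 → ℝ)
    (D : Fin 4 → Fin 4 → Fin 4 → ℝ) : Fin 4 → ℝ :=
  ![dTwo c (starTwo w) (fun e => starTwo (D e)) 1 2 3,
    dTwo c (starTwo w) (fun e => starTwo (D e)) 0 2 3,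
    -dTwo c (starTwo w) (fun e => starTwo (D e)) 0 1 3,
    dTwo c (starTwo w) (fun e => starTwo (D e)) 0 1 2]

namespace Cobase

variable {M : Type*} [TopologicalSpace M] [ChartedSpace (EuclideanSpace ℝ (Fin 4)) M]
  [IsManifold (𝓡 4) ∞ M] (g : Cobase M)

theorem comp_hodge_eq_starTwo (w : DForm M 2) (a b : Fin 4) (x : M) :
    g.comp (g.hodge (p := 2) (q := 2) rfl w) ![a, b] x =
      starTwo (fun a b => g.comp w ![a, b] x) a b := by
  obtain ⟨h01, h02, h03, h12, h13, h23⟩ := g.comp_hodge_two w x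
  have s := g.comp_two_swap (g.hodge (p := 2) (q := 2) rfl w)
  have s0 := g.comp_two_self (g.hodge (p := 2) (q := 2) rfl w)
  fin_cases a <;> fin_cases b
  exacts [s0 _ _, h01, h02, h03, (s 0 1 x).trans (congrArg _ h01), s0 _ _, h12, h13,
    ((s 0 2 x).trans (congrArg _ h02)).trans (neg_neg _),
    ((s 1 2 x).trans (congrArg _ h12)).trans (neg_neg _), s0 _ _, h23,
    (s 0 3 x).trans (congrArg _ h03), (s 1 3 x).trans (congrArg _ h13),
    ((s 2 3 x).trans (congrArg _ h23)).trans (neg_neg _), s0 _ _]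

/-- The codifferential of a `2`-form in the base field. -/
theorem comp_codiff_two {w : DForm M 2} {x : M} {D : Fin 4 → Fin 4 → Fin 4 → ℝ}
    (hw : ∀ e a b, HasDirDeriv (g.comp w ![a, b]) x (g.base e x) (D e a b)) (a : Fin 4) :
    g.comp (g.codiff (p := 1) (q := 2) rfl w) ![a] x =
      codiffTwo (fun k a b => g.struct k a b x) (fun a b => g.comp w ![a, b] x) D a := by
  have hm : ∀ a, MDifferentiableAt (𝓡 4) 𝓘(ℝ, ℝ) (g.comp w a) x := by
    intro a
    rw [fin_two_eq a]
    exact (hw 0 _ _).1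
  -- In an orthonormal base ⋆ has constant coefficients, hence commutes with directional derivatives
  -- of components.
  have hD : ∀ e a b, dirDeriv (g.comp (g.hodge (p := 2) (q := 2) rfl w) ![a, b]) x (g.base e x) =
      starTwo (D e) a b := by
    intro e a b
    rw [funext (g.comp_hodge_eq_starTwo w a b)]
    have h := fun a b => (hw e a b).2
    have h' := fun a b => (hw e a b).neg.2
    have h0 := (HasDirDeriv.const (x := x) (v := g.base e x) 0).2
    fin_cases a <;> fin_cases b
    exacts [h0, h _ _, h' _ _, h _ _, h' _ _, h0, h' _ _, h _ _, h _ _, h _ _, h0, h' _ _, h' _ _,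
      h' _ _, h _ _, h0]
  have hd : ∀ a b c, g.comp (g.hodge (p := 2) (q := 2) rfl w).d ![a, b, c] x =
      dTwo (fun k a b => g.struct k a b x) (starTwo fun a b => g.comp w ![a, b] x)
        (fun e => starTwo (D e)) a b c := by
    intro a b c
    rw [g.comp_d_two (g.mdifferentiableAt_comp_hodge rfl hm)]
    simp only [hD, comp_hodge_eq_starTwo]
    rfl
  obtain ⟨h0, h1, h2, h3⟩ := g.comp_hodge_three (g.hodge (p := 2) (q := 2) rfl w).d x
  have hn : ∀ a, g.comp (g.codiff (p := 1) (q := 2) rfl w) ![a] x =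
      -g.comp (g.hodge (p := 3) (q := 1) rfl (g.hodge (p := 2) (q := 2) rfl w).d) ![a] x :=
    fun a => g.comp_codiff rfl w ![a] x
  rw [hn]
  rw [hd] at h0 h1 h2 h3
  -- From 3-forms to 1-forms ⋆ carries a minus sign except in component 2. Combined with the sign of
  -- δ, this leaves component 2 as the only negative entry.
  fin_cases a
  · exact (congrArg _ h0).trans (neg_neg _)
  · exact (congrArg _ h1).trans (neg_neg _)
  · exact congrArg _ h2
  · exact (congrArg _ h3).trans (neg_neg _)

/-- The structure equations, `d dg^β = 0`. -/
theorem bianchi (β a b c : Fin 4) (x : M) : g.comp (g.form β).d.d ![a, b, c] x = 0 := by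
  rw [g.comp_d_two fun a => g.mdifferentiableAt_comp_d_form β a x]
  have hc : ∀ (c : ℝ) (v : TangentSpace (𝓡 4) x), dirDeriv (fun _ : M => c) x v = 0 :=
    fun c v => (HasDirDeriv.const (v := v) c).2
  -- Evaluate dg^β on ([E_a, E_b], E_c) in two ways: by expanding the bracket in the base, and by
  -- the invariant formula, where the derivative of the constant g^β(E_c) drops out.
  have key : ∀ a b c, dirDeriv (g.comp (g.form β).d ![a, b]) x (g.base c x) -
      ∑ k, g.struct k a b x * g.comp (g.form β).d ![k, c] x =
      g.form β x (fun _ => mlieBracket (𝓡 4)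
        (fun y => mlieBracket (𝓡 4) (g.base a) (g.base b) y) (g.base c) x) := by
    intro a b c
    have h1 := DForm.d_one_apply (g.smooth_form β)
      ((g.smooth_base a).mlieBracket (g.smooth_base b)) (g.smooth_base c) x
    have h2 := g.apply_vecCons (g.form β).d x (mlieBracket (𝓡 4) (g.base a) (g.base b) x)
      ![g.base c x]
    have h3 : dirDeriv (fun z => g.form β z (fun _ => g.base c z)) x
        (mlieBracket (𝓡 4) (g.base a) (g.base b) x) = 0 := by
      simp only [g.dual, hc]
    have h4 : dirDeriv (g.comp (g.form β).d ![a, b]) x (g.base c x) =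
        -dirDeriv (g.struct β a b) x (g.base c x) := by
      rw [comp_d_form]
      exact (HasDirDeriv.of_mdifferentiableAt
        ((g.smooth_struct β a b).mdifferentiableAt x) _).neg.2
    rw [h3] at h1
    simp only [comp_two]
    rw [h4]
    have h5 : ∀ k, Matrix.vecCons (g.base k x) ![g.base c x] = ![g.base k x, g.base c x] :=
      fun k => rfl
    have h6 := h2.symm.trans h1
    simp only [h5] at h6
    unfold struct
    rw [h6]
    ring
  have k1 := key a b c
  have k2 := key a c b
  have k3 := key b c a
  have : IsManifold (𝓡 4) (minSmoothness ℝ 3) M := by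
    rw [minSmoothness_of_isRCLikeNormedField]
    exact IsManifold.of_le (n := ∞) (WithTop.coe_le_coe.2 (le_top : (3 : ℕ∞) ≤ ⊤))
  have hs : ∀ k, ContMDiffAt (𝓡 4) (𝓡 4).tangent (minSmoothness ℝ 2)
      (fun x => (⟨x, g.base k x⟩ : TangentBundle (𝓡 4) M)) x := by
    intro k
    rw [minSmoothness_of_isRCLikeNormedField]
    exact (g.smooth_base k x).of_le (WithTop.coe_le_coe.2 (le_top : (2 : ℕ∞) ≤ ⊤))
  -- The component of ddg^β is an alternating sum of three double brackets, which cancels by the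
  -- Jacobi identity.
  have jac := leibniz_identity_mlieBracket_apply (I := 𝓡 4) (x := x) (U := g.base a)
    (V := g.base b) (W := g.base c)
    (hs a) (hs b) (hs c)
  have h7 := congrArg (fun v => g.form β x (fun _ => v)) jac
  simp only [one_form_add] at h7
  have h8 : ∀ a b c : Fin 4, g.form β x (fun _ => mlieBracket (𝓡 4)
        (fun y => mlieBracket (𝓡 4) (g.base a) (g.base b) y) (g.base c) x) =
      -g.form β x (fun _ => mlieBracket (𝓡 4) (g.base c)
        (mlieBracket (𝓡 4) (g.base a) (g.base b)) x) := by
    intro a b c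
    rw [mlieBracket_swap_apply, one_form_neg]
  rw [h8 a c b] at k2
  rw [h8 b c a] at k3
  linarith

end Cobase
end GravForce

/-! ### Algebra of the Maxwell energy-momentum tensor. -/

namespace GravForce

open VectorField Topology

/-- The contraction `T_{ak} X^k` of the energy-momentum tensor of a `2`-form with a vector. -/
noncomputable def stress (F : Fin 4 → Fin 4 → ℝ) (X : Fin 4 → ℝ) (a : Fin 4) : ℝ :=
  (∑ k, ∑ c, eta c * X k * (F a c * F k c)) -
    1 / 4 * eta a * X a * ∑ b, ∑ c, eta b * eta c * (F b c * F b c)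

/-- The derivative of `stress`, given the derivatives of `F` and `X`. -/
noncomputable def stressDeriv (F F' : Fin 4 → Fin 4 → ℝ) (X X' : Fin 4 → ℝ) (a : Fin 4) : ℝ :=
  (∑ k, ∑ c, (eta c * X' k * (F a c * F k c) +
    eta c * X k * (F' a c * F k c + F a c * F' k c))) -
    (1 / 4 * eta a * X' a * (∑ b, ∑ c, eta b * eta c * (F b c * F b c)) +
      1 / 4 * eta a * X a * ∑ b, ∑ c, eta b * eta c * (F' b c * F b c + F b c * F' b c))

/-- The components of `F ∧ i_X ⋆F - i_X F ∧ ⋆F` for a `2`-form `F`. -/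
noncomputable def flowForm (F : Fin 4 → Fin 4 → ℝ) (X : Fin 4 → ℝ) (a b c : Fin 4) : ℝ :=
  (F a b * ∑ k, X k * starTwo F k c) - (F a c * ∑ k, X k * starTwo F k b) +
    (F b c * ∑ k, X k * starTwo F k a) -
  (((∑ k, X k * F k a) * starTwo F b c) - ((∑ k, X k * F k b) * starTwo F a c) +
    ((∑ k, X k * F k c) * starTwo F a b))

/-- The classical equality of the two expressions for Maxwell energy-momentum. The signs are
opposite to those of ⋆ from 3-forms to 1-forms, so ½⋆ of the left-hand form is minus the stress
covector in every component. -/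
theorem flowForm_eq_stress {F : Fin 4 → Fin 4 → ℝ} (hF : ∀ a b, F b a = -F a b)
    (X : Fin 4 → ℝ) :
    flowForm F X 1 2 3 = 2 * stress F X 0 ∧ flowForm F X 0 2 3 = 2 * stress F X 1 ∧
    flowForm F X 0 1 3 = -(2 * stress F X 2) ∧ flowForm F X 0 1 2 = 2 * stress F X 3 := by
  have h0 : ∀ a, F a a = 0 := fun a => by linarith [hF a a]
  have h01 := hF 0 1
  have h02 := hF 0 2
  have h03 := hF 0 3
  have h12 := hF 1 2
  have h13 := hF 1 3
  have h23 := hF 2 3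
  simp only [flowForm, stress, starTwo, Fin.sum_univ_four, eta_values, h0, h01, h02, h03, h12, h13,
    h23, Matrix.cons_val]
  refine ⟨?_, ?_, ?_, ?_⟩ <;> ring

/-- The divergence of the energy-momentum tensor of a closed `2`-form along a Killing field. -/
theorem divergence_stress {F : Fin 4 → Fin 4 → ℝ} {D c : Fin 4 → Fin 4 → Fin 4 → ℝ}
    {X : Fin 4 → ℝ} {DX : Fin 4 → Fin 4 → ℝ}
    (hF : ∀ a b, F b a = -F a b) (hD : ∀ e a b, D e b a = -D e a b)
    (hc : ∀ k a b, c k b a = -c k a b)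
    (hK : ∀ a b, eta b * (DX a b - ∑ k, X k * c b k a) +
      eta a * (DX b a - ∑ k, X k * c a k b) = 0)
    (hB : ∀ i j k, dTwo c F D i j k = 0) :
    ∑ a, eta a * (stressDeriv F (D a) X (DX a) a + stress F X a * ∑ b, c b b a) =
      ∑ a, eta a * (∑ k, X k * F k a) * codiffTwo c F D a := by
  have f0 : ∀ a, F a a = 0 := fun a => by linarith [hF a a]
  have f01 := hF 0 1
  have f02 := hF 0 2
  have f03 := hF 0 3
  have f12 := hF 1 2
  have f13 := hF 1 3
  have f23 := hF 2 3
  have d0 : ∀ e a, D e a a = 0 := fun e a => by linarith [hD e a a]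
  have d01 := fun e => hD e 0 1
  have d02 := fun e => hD e 0 2
  have d03 := fun e => hD e 0 3
  have d12 := fun e => hD e 1 2
  have d13 := fun e => hD e 1 3
  have d23 := fun e => hD e 2 3
  have c0 : ∀ k a, c k a a = 0 := fun k a => by linarith [hc k a a]
  have c01 := fun k => hc k 0 1
  have c02 := fun k => hc k 0 2
  have c03 := fun k => hc k 0 3
  have c12 := fun k => hc k 1 2
  have c13 := fun k => hc k 1 3
  have c23 := fun k => hc k 2 3
  have K00 := hK 0 0
  have K01 := hK 0 1
  have K02 := hK 0 2
  have K03 := hK 0 3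
  have K11 := hK 1 1
  have K12 := hK 1 2
  have K13 := hK 1 3
  have K22 := hK 2 2
  have K23 := hK 2 3
  have K33 := hK 3 3
  have B012 := hB 0 1 2
  have B013 := hB 0 1 3
  have B023 := hB 0 2 3
  have B123 := hB 1 2 3
  clear hF hD hc hK hB
  simp only [dTwo, Fin.sum_univ_four, eta_values, f0, f01, f02, f03, f12, f13, f23, c0, c01, c02,
    c03, c12, c13, c23] at K00 K01 K02 K03 K11 K12 K13 K22 K23 K33 B012 B013 B023 B123
  simp only [stress, stressDeriv, codiffTwo, dTwo, starTwo, Fin.sum_univ_four, eta_values, f0, f01,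
    f02, f03, f12, f13, f23, d0, d01, d02, d03, d12, d13, d23, c0, c01, c02, c03, c12, c13, c23,
    Matrix.cons_val]
  -- The Killing relations are weighted by the stress tensor with raised indices, T^{ab} off the
  -- diagonal and ½T^{aa} on it: together they form T^{ab} ∇_a X_b. The closedness relations are
  -- weighted by the components of -(F ∧ X♭) with raised indices, so they form -⟨F ∧ X♭ | dF⟩.
  linear_combination
    ((1/4) * F 0 1 * F 0 1 + (1/4) * F 0 2 * F 0 2 + (1/4) * F 0 3 * F 0 3 + (1/4) * F 1 2 * F
    1 2 + (1/4) * F 1 3 * F 1 3 + (1/4) * F 2 3 * F 2 3) * K00 + (-F 0 2 * F 1 2 - F 0 3 * F 1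
    3) * K01 + (F 0 1 * F 1 2 - F 0 3 * F 2 3) * K02 + (F 0 1 * F 1 3 + F 0 2 * F 2 3) * K03 +
    ((-1/4) * F 0 1 * F 0 1 + (1/4) * F 0 2 * F 0 2 + (1/4) * F 0 3 * F 0 3 + (1/4) * F 1 2 * F
    1 2 + (1/4) * F 1 3 * F 1 3 + (-1/4) * F 2 3 * F 2 3) * K11 + (-F 0 1 * F 0 2 + F 1 3 * F 2
    3) * K12 + (-F 0 1 * F 0 3 - F 1 2 * F 2 3) * K13 + ((1/4) * F 0 1 * F 0 1 + (-1/4) * F 0 2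
    * F 0 2 + (1/4) * F 0 3 * F 0 3 + (1/4) * F 1 2 * F 1 2 + (-1/4) * F 1 3 * F 1 3 + (1/4) *
    F 2 3 * F 2 3) * K22 + (-F 0 2 * F 0 3 + F 1 2 * F 1 3) * K23 + ((1/4) * F 0 1 * F 0 1 +
    (1/4) * F 0 2 * F 0 2 + (-1/4) * F 0 3 * F 0 3 + (-1/4) * F 1 2 * F 1 2 + (1/4) * F 1 3 * F
    1 3 + (1/4) * F 2 3 * F 2 3) * K33 + (F 0 1 * X 2 - F 0 2 * X 1 - F 1 2 * X 0) * B012 + (F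
    0 1 * X 3 - F 0 3 * X 1 - F 1 3 * X 0) * B013 + (F 0 2 * X 3 - F 0 3 * X 2 - F 2 3 * X 0) *
    B023 + (-F 1 2 * X 3 + F 1 3 * X 2 - F 2 3 * X 1) * B123

section

variable {M : Type*} [TopologicalSpace M] [ChartedSpace (EuclideanSpace ℝ (Fin 4)) M]

theorem HasDirDeriv.stress {F : Fin 4 → Fin 4 → M → ℝ} {X : Fin 4 → M → ℝ} {x : M}
    {v : TangentSpace (𝓡 4) x} {F' : Fin 4 → Fin 4 → ℝ} {X' : Fin 4 → ℝ}
    (hF : ∀ a b, HasDirDeriv (F a b) x v (F' a b)) (hX : ∀ k, HasDirDeriv (X k) x v (X' k))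
    (a : Fin 4) :
    HasDirDeriv (fun y => GravForce.stress (fun a b => F a b y) (fun k => X k y) a) x v
      (stressDeriv (fun a b => F a b x) F' (fun k => X k x) X' a) := by
  unfold GravForce.stress
  refine HasDirDeriv.congr (HasDirDeriv.sub (HasDirDeriv.sum _ fun k => HasDirDeriv.sum _ fun c =>
    ((HasDirDeriv.const _).mul (hX k)).mul ((hF a c).mul (hF k c)))
    (((HasDirDeriv.const _).mul (hX a)).mul (HasDirDeriv.sum _ fun b => HasDirDeriv.sum _ fun c =>
      (HasDirDeriv.const _).mul ((hF b c).mul (hF b c))))) ?_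
  simp only [stressDeriv, zero_mul, zero_add]

end

end GravForce

/-! ### Energy-flow, Killing equation and the divergence identity. -/

namespace GravForce

open VectorField Topology

theorem codiffTwo_smul (c : Fin 4 → Fin 4 → Fin 4 → ℝ) (r : ℝ) (F : Fin 4 → Fin 4 → ℝ)
    (D : Fin 4 → Fin 4 → Fin 4 → ℝ) (a : Fin 4) :
    codiffTwo c (fun a b => r * F a b) (fun e a b => r * D e a b) a = r * codiffTwo c F D a := by
  fin_cases a <;>
  · simp only [codiffTwo, dTwo, starTwo, Fin.sum_univ_four, Fin.zero_eta, Fin.mk_one,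
      Fin.reduceFinMk, Matrix.cons_val]
    ring

namespace Cobase

variable {M : Type*} [TopologicalSpace M] [ChartedSpace (EuclideanSpace ℝ (Fin 4)) M]
  [IsManifold (𝓡 4) ∞ M] (g : Cobase M)

/-- The components `X^k = g^k(X)` of a vector field. -/
noncomputable def coord (X : VField M) (k : Fin 4) : M → ℝ := fun x => g.form k x (fun _ => X x)

theorem smooth_coord {X : VField M} (hX : X.Smooth) (k : Fin 4) : SmoothFun (g.coord X k) :=
  (g.smooth_form k).apply_smooth hX

theorem comp_interior_one (X : VField M) (w : DForm M 2) (a : Fin 4) (x : M) :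
    g.comp (DForm.interior X w) ![a] x = ∑ k, g.coord X k x * g.comp w ![k, a] x := by
  have h := g.apply_vecCons w x (X x) ![g.base a x]
  simp only [comp_two]
  refine Eq.trans ?_ h
  change w x _ = w x _
  congr 1
  funext i
  fin_cases i <;> rfl

theorem comp_wedge_two_one (w : DForm M 2) (η : DForm M 1) (a b c : Fin 4) (x : M) :
    g.comp (DForm.wedge w η : DForm M 3) ![a, b, c] x =
      g.comp w ![a, b] x * g.comp η ![c] x - g.comp w ![a, c] x * g.comp η ![b] x +
        g.comp w ![b, c] x * g.comp η ![a] x := by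
  have h1 : ∀ a, ![g.base a x] = fun _ => g.base a x := fun a => by
    funext i; fin_cases i; rfl
  rw [comp_three]
  refine (wedgeAt_two_one (w x) (η x) _ _ _).trans ?_
  simp only [comp_two, comp_one, h1]

theorem comp_wedge_one_two (w : DForm M 1) (η : DForm M 2) (a b c : Fin 4) (x : M) :
    g.comp (DForm.wedge w η : DForm M 3) ![a, b, c] x =
      g.comp w ![a] x * g.comp η ![b, c] x - g.comp w ![b] x * g.comp η ![a, c] x +
        g.comp w ![c] x * g.comp η ![a, b] x := by
  have h1 : ∀ a, ![g.base a x] = fun _ => g.base a x := fun a => by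
    funext i; fin_cases i; rfl
  rw [comp_three]
  refine (wedgeAt_one_two (w x) (η x) _ _ _).trans ?_
  simp only [comp_two, comp_one, h1]

theorem comp_sum {p : ℕ} {ι : Type*} (s : Finset ι) (w : ι → DForm M p) (a : Fin p → Fin 4)
    (x : M) : g.comp (∑ i ∈ s, w i) a x = ∑ i ∈ s, g.comp (w i) a x := by
  unfold comp
  rw [Finset.sum_apply, ContinuousAlternatingMap.sum_apply]

theorem comp_sub {p : ℕ} (w ψ : DForm M p) (a : Fin p → Fin 4) (x : M) :
    g.comp (w - ψ) a x = g.comp w a x - g.comp ψ a x := rfl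

theorem comp_smul {p : ℕ} (c : ℝ) (w : DForm M p) (a : Fin p → Fin 4) (x : M) :
    g.comp (c • w) a x = c * g.comp w a x := rfl

/-- The components of `dg^β`. -/
noncomputable def fieldStrength (β a b : Fin 4) : M → ℝ := g.comp (g.form β).d ![a, b]

/-- The ½ cancels the factor 2 in `flowForm_eq_stress`, the overall minus sign comes from ⋆ on
3-forms, and η_β from the lowered index of one factor. -/
theorem comp_energyFlow (X : VField M) (a : Fin 4) (x : M) :
    g.comp (g.energyFlow X) ![a] x = ∑ β, -eta β *
      stress (fun a b => g.fieldStrength β a b x) (fun k => g.coord X k x) a := by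
  have hτ : ∀ a b c, g.comp (∑ β,
      ((DForm.wedge (DForm.d (g.lower β))
        (DForm.interior X (g.hodge (p := 2) (q := 2) rfl (DForm.d (g.form β)))) : DForm M 3) -
      (DForm.wedge (DForm.interior X (DForm.d (g.lower β)))
        (g.hodge (p := 2) (q := 2) rfl (DForm.d (g.form β))) : DForm M 3))) ![a, b, c] x =
      ∑ β, eta β * flowForm (fun a b => g.fieldStrength β a b x) (fun k => g.coord X k x)
        a b c := by
    intro a b c
    rw [comp_sum]
    refine Finset.sum_congr rfl fun β _ => ?_
    rw [comp_sub, comp_wedge_two_one, comp_wedge_one_two, d_lower]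
    simp only [comp_interior_one, comp_smul, comp_hodge_eq_starTwo, flowForm, fieldStrength]
    simp only [mul_left_comm _ (eta β), ← Finset.mul_sum]
    ring
  have hs : ∀ β, _ := fun β => flowForm_eq_stress (F := fun a b => g.fieldStrength β a b x)
    (fun a b => g.comp_two_swap _ a b x) (fun k => g.coord X k x)
  have hw := g.comp_hodge_three (∑ β,
      ((DForm.wedge (DForm.d (g.lower β))
        (DForm.interior X (g.hodge (p := 2) (q := 2) rfl (DForm.d (g.form β)))) : DForm M 3) -
      (DForm.wedge (DForm.interior X (DForm.d (g.lower β)))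
        (g.hodge (p := 2) (q := 2) rfl (DForm.d (g.form β))) : DForm M 3))) x
  rw [hτ, hτ, hτ, hτ] at hw
  obtain ⟨h0, h1, h2, h3⟩ := hw
  simp only [fun β => (hs β).1, fun β => (hs β).2.1, fun β => (hs β).2.2.1,
    fun β => (hs β).2.2.2] at h0 h1 h2 h3
  have hE : ∀ a, g.comp (g.energyFlow X) ![a] x = 1 / 2 * _ := fun a => g.comp_smul _ _ ![a] x
  have e0 : g.comp (g.energyFlow X) ![0] x = ∑ β, -eta β *
      stress (fun a b => g.fieldStrength β a b x) (fun k => g.coord X k x) 0 := by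
    rw [hE, h0, Fin.sum_univ_four, Fin.sum_univ_four]
    ring
  have e1 : g.comp (g.energyFlow X) ![1] x = ∑ β, -eta β *
      stress (fun a b => g.fieldStrength β a b x) (fun k => g.coord X k x) 1 := by
    rw [hE, h1, Fin.sum_univ_four, Fin.sum_univ_four]
    ring
  have e2 : g.comp (g.energyFlow X) ![2] x = ∑ β, -eta β *
      stress (fun a b => g.fieldStrength β a b x) (fun k => g.coord X k x) 2 := by
    rw [hE, h2, Fin.sum_univ_four, Fin.sum_univ_four]
    ring
  have e3 : g.comp (g.energyFlow X) ![3] x = ∑ β, -eta β *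
      stress (fun a b => g.fieldStrength β a b x) (fun k => g.coord X k x) 3 := by
    rw [hE, h3, Fin.sum_univ_four, Fin.sum_univ_four]
    ring
  fin_cases a
  exacts [e0, e1, e2, e3]

/-- Evaluate dg^k on (X, E_a): the derivative of the constant g^k(E_a) vanishes, and the remaining
terms express E_a(X^k) through the bracket [X, E_a]. -/
theorem dirDeriv_coord {X : VField M} (hX : X.Smooth) (a k : Fin 4) (x : M) :
    dirDeriv (g.coord X k) x (g.base a x) = ∑ b, g.coord X b x * g.struct k b a x -
      g.form k x (fun _ => mlieBracket (𝓡 4) X (g.base a) x) := by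
  have h := DForm.d_one_apply (g.smooth_form k) hX (g.smooth_base a) x
  have h1 := g.comp_interior_one X (g.form k).d a x
  have h2 : g.comp (DForm.interior X (g.form k).d) ![a] x =
      (g.form k).d x ![X x, g.base a x] := by
    change (g.form k).d x _ = _
    congr 1
    funext i
    fin_cases i <;> rfl
  have h3 : dirDeriv (fun z => g.form k z (fun _ => g.base a z)) x (X x) = 0 := by
    simp only [g.dual]
    exact (HasDirDeriv.const (v := X x) _).2
  rw [h2, h, h3] at h1
  simp only [comp_d_form, mul_neg, Finset.sum_neg_distrib] at h1
  unfold coord at h1 ⊢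
  linarith

theorem metric_base_right (a : Fin 4) (x : M) (u : TangentSpace (𝓡 4) x) :
    g.metric x u (g.base a x) = eta a * g.form a x (fun _ => u) := by
  unfold metric
  simp only [g.dual, mul_ite, mul_one, mul_zero]
  simp

theorem metric_base_left (a : Fin 4) (x : M) (u : TangentSpace (𝓡 4) x) :
    g.metric x (g.base a x) u = eta a * g.form a x (fun _ => u) := by
  unfold metric
  simp only [g.dual, mul_ite, mul_one, mul_zero, ite_mul, zero_mul]
  simp

/-- The functions 𝐠(E_a, E_b) are constant, so the Killing condition on two base fields retains only
its bracket terms. -/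
theorem IsKilling.bracket_antisymm {ξ : VField M} (hξ : g.IsKilling ξ) (a b : Fin 4) (x : M) :
    eta b * g.form b x (fun _ => mlieBracket (𝓡 4) ξ (g.base a) x) +
      eta a * g.form a x (fun _ => mlieBracket (𝓡 4) ξ (g.base b) x) = 0 := by
  have h := hξ.2 (g.base a) (g.base b) (g.smooth_base a) (g.smooth_base b) x
  rw [g.metric_base_right b x (mlieBracket (𝓡 4) ξ (g.base a) x),
    g.metric_base_left a x (mlieBracket (𝓡 4) ξ (g.base b) x)] at h
  refine h.symm.trans ?_
  change dirDeriv (fun y => g.metric y (g.base a y) (g.base b y)) x (ξ x) = 0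
  simp only [metric_base_right, g.dual]
  exact (HasDirDeriv.const (v := ξ x) _).2

/-- The Killing equation in the base field. -/
theorem IsKilling.dirDeriv_coord {ξ : VField M} (hξ : g.IsKilling ξ) (a b : Fin 4) (x : M) :
    eta b * (dirDeriv (g.coord ξ b) x (g.base a x) -
        ∑ k, g.coord ξ k x * g.struct b k a x) +
      eta a * (dirDeriv (g.coord ξ a) x (g.base b x) -
        ∑ k, g.coord ξ k x * g.struct a k b x) = 0 := by
  have h := IsKilling.bracket_antisymm g hξ a b x
  rw [g.dirDeriv_coord hξ.1, g.dirDeriv_coord hξ.1]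
  linarith

theorem hasDirDeriv_fieldStrength (β a b : Fin 4) (x : M) (v : TangentSpace (𝓡 4) x) :
    HasDirDeriv (g.fieldStrength β a b) x v (dirDeriv (g.fieldStrength β a b) x v) :=
  .of_mdifferentiableAt (g.mdifferentiableAt_comp_d_form β ![a, b] x) v

theorem comp_codiffD (α a : Fin 4) (x : M) :
    g.comp (g.codiffD α) ![a] x = eta α * codiffTwo (fun k a b => g.struct k a b x)
      (fun a b => g.fieldStrength α a b x)
      (fun e a b => dirDeriv (g.fieldStrength α a b) x (g.base e x)) a := by
  unfold codiffD
  rw [d_lower]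
  have h : ∀ e a b, HasDirDeriv (g.comp (eta α • (g.form α).d) ![a, b]) x (g.base e x)
      (eta α * dirDeriv (g.fieldStrength α a b) x (g.base e x)) := by
    intro e a b
    refine ((HasDirDeriv.const (eta α)).mul (g.hasDirDeriv_fieldStrength α a b x _)).congr ?_
    rw [zero_mul, zero_add]
  refine (g.comp_codiff_two h a).trans ?_
  simp only [comp_smul]
  change codiffTwo _ (fun a b => eta α * g.fieldStrength α a b x) _ a = _
  exact codiffTwo_smul _ _ _ _ a

/-- `divergence_stress` applies to each closed 2-form dg^β separately; β enters only through the
weight η_β. The field equations are not involved yet. -/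
theorem codiffOne_energyFlow {ξ : VField M} (hξ : g.IsKilling ξ) (x : M) :
    g.codiffOne (g.energyFlow ξ) x = -∑ β, eta β * ∑ a, eta a *
      (∑ k, g.coord ξ k x * g.fieldStrength β k a x) *
      codiffTwo (fun k a b => g.struct k a b x) (fun a b => g.fieldStrength β a b x)
      (fun e a b => dirDeriv (g.fieldStrength β a b) x (g.base e x)) a := by
  have hX : ∀ e k, HasDirDeriv (g.coord ξ k) x (g.base e x)
      (dirDeriv (g.coord ξ k) x (g.base e x)) := fun e k =>
    .of_mdifferentiableAt ((g.smooth_coord hξ.1 k).mdifferentiableAt x) _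
  have hw : ∀ e a, HasDirDeriv (g.comp (g.energyFlow ξ) ![a]) x (g.base e x)
      (∑ β, -eta β * stressDeriv (fun a b => g.fieldStrength β a b x)
        (fun a b => dirDeriv (g.fieldStrength β a b) x (g.base e x)) (fun k => g.coord ξ k x)
        (fun k => dirDeriv (g.coord ξ k) x (g.base e x)) a) := by
    intro e a
    rw [funext (g.comp_energyFlow ξ a)]
    refine HasDirDeriv.sum _ fun β => ((HasDirDeriv.const (-eta β)).mul (HasDirDeriv.stress
      (fun a b => g.hasDirDeriv_fieldStrength β a b x _) (hX e) a)).congr ?_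
    rw [zero_mul, zero_add]
  have key := fun β => divergence_stress (F := fun a b => g.fieldStrength β a b x)
    (D := fun e a b => dirDeriv (g.fieldStrength β a b) x (g.base e x))
    (c := fun k a b => g.struct k a b x) (X := fun k => g.coord ξ k x)
    (DX := fun e k => dirDeriv (g.coord ξ k) x (g.base e x))
    (fun a b => g.comp_two_swap _ a b x)
    (fun e a b => by
      have h : g.fieldStrength β b a = fun y => -g.fieldStrength β a b y :=
        funext fun y => g.comp_two_swap _ a b y
      rw [h]
      exact (g.hasDirDeriv_fieldStrength β a b x _).neg.2)
    (fun k a b => g.struct_swap k a b x)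
    (fun a b => IsKilling.dirDeriv_coord g hξ a b x)
    (fun a b c => ((g.comp_d_two (fun a => g.mdifferentiableAt_comp_d_form β a x) a b c).symm.trans
      (g.bianchi β a b c x)))
  rw [g.codiffOne_eq hw, ← Finset.sum_neg_distrib]
  simp only [← key]
  simp only [comp_energyFlow]
  -- Exchanges the sum over potentials with the sum over base directions, so that the inner sum is
  -- the divergence for a single dg^β.
  have swap : ∀ (s t : Fin 4 → Fin 4 → ℝ) (T : Fin 4 → ℝ),
      ∑ a, eta a * (∑ β, -eta β * t β a + (∑ β, -eta β * s β a) * T a) =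
        ∑ β, -(eta β * ∑ a, eta a * (t β a + s β a * T a)) := by
    intro s t T
    simp only [mul_add, Finset.mul_sum, Finset.sum_mul, ← Finset.sum_add_distrib,
      ← Finset.sum_neg_distrib]
    rw [Finset.sum_comm]
    refine Finset.sum_congr rfl fun β _ => Finset.sum_congr rfl fun a _ => ?_
    ring
  exact swap
    (fun β a => stress (fun a b => g.fieldStrength β a b x) (fun k => g.coord ξ k x) a)
    (fun β a => stressDeriv (fun a b => g.fieldStrength β a b x)
      (fun i j => dirDeriv (g.fieldStrength β i j) x (g.base a x)) (fun k => g.coord ξ k x)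
      (fun k => dirDeriv (g.coord ξ k) x (g.base a x)) a)
    (fun a => ∑ b, g.struct b b a x)

end Cobase

end GravForce

theorem mainTheorem5
    {M : Type*} [TopologicalSpace M] [ChartedSpace (EuclideanSpace ℝ (Fin 4)) M]
    [IsManifold (𝓡 4) ∞ M]
    (g : GravForce.Cobase M) (J : Fin 4 → GravForce.DForm M 1)
    (hg : g.FieldEquations J)
    (ξ : GravForce.VField M) (hξ : g.IsKilling ξ) (x : M) :
    g.codiffOne (g.energyFlow ξ) x =
      -∑ α, g.inner (GravForce.DForm.interior ξ (GravForce.DForm.d (g.lower α)))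
        (GravForce.eta α • (g.current α + J α)) x := by
  rw [g.codiffOne_energyFlow hξ]
  congr 1
  refine Finset.sum_congr rfl fun α _ => ?_
  -- The only place where the field equations enter: the total current is replaced by δdg_α.
  rw [← hg α]
  unfold GravForce.Cobase.inner
  rw [Finset.mul_sum]
  refine Finset.sum_congr rfl fun a _ => ?_
  rw [← g.comp_one, ← g.comp_one, g.comp_interior_one, g.comp_smul, g.comp_codiffD, g.d_lower]
  simp only [g.comp_smul, mul_left_comm _ (GravForce.eta α), ← Finset.mul_sum]
  -- On the right η_α occurs three times (lowering in dg_α, lowering in δdg_α, raising the current),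
  -- on the left once.
  have h : GravForce.eta α * GravForce.eta α = 1 := by
    unfold GravForce.eta
    split_ifs <;> norm_num
  unfold GravForce.Cobase.fieldStrength
  generalize GravForce.codiffTwo _ _ _ a = C
  generalize ∑ k, g.coord ξ k x * g.comp (g.form α).d ![k, a] x = S
  linear_combination (-(GravForce.eta α * GravForce.eta a * S * C)) * h
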